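/- Let $p$ be a prime, let $\eta\in\mathbb Z[t]$ be monic and irreducible modulo $p$, $d=\deg\eta$, $q=p^d$, $R=\mathbb Z[t]/(\eta)$ and, for $\varepsilon\ge 1$, $R_\varepsilon=R/(p^\varepsilon)$ (a Galois ring; $R_1=\mathbb F_q$). Let $e\ge 1$, let $f,m\in R[x]$ be monic with $1\le\deg f<\deg m=n$, and let $\Gamma_e(f,m)$ be the map $g\mapsto fg$ on the finite set $R_e[x]/(m)$. Its functional graph consists of disjoint cycles whose vertices are roots of (possibly trivial) trees; the *height* of the system is the maximum, over these trees, of the number of edges on a path from a leaf to the root. Let $\ell_{\max}$ be the largest length of a cycle of $\Gamma_e(f,m)$. Consider the following algorithm, with input the residues of $f,m$ in $R_e[x]$, the number $e$ and $\ell_{\max}$. 1. Reduce $f,m$ modulo $p$ to $F,\bar m\in\mathbb F_q[x]$, and factor $F=G_1^{k_1}\cdots G_s^{k_s}$ with distinct monic irreducible $G_i$. 2. Write $\bar m=M_1M_2$, where $M_1$ is the greatest monic divisor of $\bar m$ coprime to $F$, and compute $\tau=\max_i\lceil\kappa_{G_i}(M_2)/\kappa_{G_i}(F)\rceil$, where $\kappa_G(Z)$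 is the exponent of $G$ in $Z$. 3. Set $r=e\tau$ and $l=\tau$. 4. While $l\le r$: set $h=l+\lfloor (r-l)/2\rfloor$; if $f^{h+\ell_{\max}}\equiv f^{h}\pmod{m}$ in $R_e[x]$, set $r=h-1$, otherwise set $l=h+1$. 5. If $f^{h+\ell_{\max}}\equiv f^{h}\pmod{m}$ in $R_e[x]$, return $h$; otherwise return $h+1$. In step 2, $M_1,M_2$ and the exponents $\kappa_{G_i}(M_2)$ are found by repeated division by the $G_i$; the powers modulo $m$ in steps 4 and 5 are computed by square-and-multiply. Time is counted as follows. Let $\mathcal M_\varepsilon(k)\ge 1$, nondecreasing in $\varepsilon$ and in $k$, be the time for multiplying two polynomials of degree less than $k$ over $R_\varepsilon$. Division with remainder of $a$ by a monic $b$ over $R_\varepsilon$ takes time $O(\mathcal M_\varepsilon(\max\{\deg a+1-\deg b,\deg b\}))$, and factoring a polynomial with $k=\deg+1$ coefficients over $\mathbb F_q$ takes time $O(k\,\mathcal M_1(k)\log(kq))$. The remaining operations (integer arithmetic, copying and comparing polynomials, reduction modulo $p$) are charged the number of bit operations of the schoolbook methods, up to a constant factor. Then for every such input the algorithm halts and returns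 the height of the system $(R_e[x]/(m),\Gamma_e(f,m))$, and it runs in time $O^{\sim}(n^2e^2\,\mathcal M_e(n))$. That is, there are constants $C$ and $K$, depending only on the implied constants in the times of the primitive operations, such that the running time is at most $C\,n^2e^2\,\mathcal M_e(n)\,(\log(neq))^{K}$ for all $p,\eta,e,f,m$ and all $\mathcal M$ as above. -/

import Mathlib

open Polynomial

namespace GaloisHeight

/-! ### Finite dynamical systems -/

section Dynamics

variable {X : Type*}

/-- The preperiod of `x`: the least `τ` with `Γ^(τ+ℓ) x = Γ^τ x` for some `ℓ > 0`. -/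
noncomputable def preperiod (Γ : X → X) (x : X) : ℕ :=
  sInf {τ | ∃ ℓ, 0 < ℓ ∧ Γ^[τ + ℓ] x = Γ^[τ] x}

/-- The period of `x`: the least `ℓ > 0` with `Γ^(τ+ℓ) x = Γ^τ x`, where `τ` is the preperiod. -/
noncomputable def period (Γ : X → X) (x : X) : ℕ :=
  sInf {ℓ | 0 < ℓ ∧ Γ^[preperiod Γ x + ℓ] x = Γ^[preperiod Γ x] x}

/-- The set of cycle lengths. -/
def cycleLengths (Γ : X → X) : Set ℕ := Set.range (period Γ)

/-- In the functional graph of `Γ`, the path from `x` with `k` edges ends in `c` and all its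
vertices before the last lie off the cycles. For `c` on a cycle this says that `x` is a vertex of
the tree rooted at `c`, and that the path from `x` to the root has `k` edges. -/
def TreePath (Γ : X → X) (c x : X) (k : ℕ) : Prop :=
  Γ^[k] x = c ∧ ∀ j < k, Γ^[j] x ∉ Function.periodicPts Γ

/-- `x` is a leaf of its tree: it has no predecessor off the cycles (the edges of the cycles do
not belong to the trees). -/
def IsLeaf (Γ : X → X) (x : X) : Prop := ∀ y, Γ y = x → y ∈ Function.periodicPts Γ

/-- `t` is the height of the tree rooted at the cycle vertex `c`. -/
def IsTreeHeight (Γ : X → X) (c : X) (t : ℕ) : Prop :=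
  IsGreatest {k | ∃ x, IsLeaf Γ x ∧ TreePath Γ c x k} t

/-- `H` is the height of the system `(X, Γ)`: the maximum height of its trees. -/
def IsSystemHeight (Γ : X → X) (H : ℕ) : Prop :=
  IsGreatest {t | ∃ c ∈ Function.periodicPts Γ, IsTreeHeight Γ c t} H

end Dynamics

/-! ### Galois rings and multiplication maps -/

/-- The ring `R_e = R / (p^e)` with `R = ℤ[t] / (h)`. -/
abbrev GR (h : ℤ[X]) (p e : ℕ) : Type :=
  AdjoinRoot h ⧸ Ideal.span {((p : AdjoinRoot h)) ^ e}

/-- The canonical map `R[x] → R_e[x]`. -/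
noncomputable def proj (h : ℤ[X]) (p e : ℕ) (f : (AdjoinRoot h)[X]) : (GR h p e)[X] :=
  f.map (Ideal.Quotient.mk _)

/-- The system function: multiplication by `f` on `R_e[x] / (m)`. -/
noncomputable def mulSystem (h : ℤ[X]) (p e : ℕ) (f m : (AdjoinRoot h)[X]) :
    ((GR h p e)[X] ⧸ Ideal.span {proj h p e m}) → ((GR h p e)[X] ⧸ Ideal.span {proj h p e m}) :=
  fun g => Ideal.Quotient.mk _ (proj h p e f) * g

/-- Reduction modulo `p`, `R_e → R_1`, for `e ≥ 1`. -/
noncomputable def residue (h : ℤ[X]) (p e : ℕ) [NeZero e] : GR h p e →+* GR h p 1 :=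
  Ideal.Quotient.factor (by
    rw [Ideal.span_singleton_le_span_singleton]
    exact pow_dvd_pow _ (NeZero.one_le))

/-- The factorization of `F`: a list of the pairs `(G, k)`, one for every monic irreducible divisor
`G` of `F`, where `k` is the exponent of `G` in `F`. -/
noncomputable def factorList {K : Type*} [CommRing K] (F : K[X]) : List (K[X] × ℕ) :=
  open Classical in
  if hS : {G : K[X] | G.Monic ∧ Irreducible G ∧ G ∣ F}.Finite then
    hS.toFinset.toList.map fun G => (G, multiplicity G F)
  else []

/-! ### The machine

A register machine with registers for integers, for polynomials over `R_e` and for polynomials over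
`R_1 = 𝔽_q`, and a list of factors that is read sequentially. Programs are built from instructions
by sequencing, branching and loops. -/

/-- Integer registers. -/
inductive ZVar
  | e | ellMax | tau | l | r | h | k | kappa | ratio | x | out
  deriving DecidableEq

/-- Registers for polynomials over `R_e`. -/
inductive PVar
  | f | m | base | lhs | rhs
  deriving DecidableEq

/-- Registers for polynomials over `R_1`. -/
inductive FVar
  | F | M1 | M2 | G | A
  deriving DecidableEq

/-- Integer expressions. -/
inductive ZExpr
  | var (v : ZVar)
  | const (a : ℤ)
  | add (a b : ZExpr)
  | sub (a b : ZExpr)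
  | mul (a b : ZExpr)
  /-- `⌊a / 2⌋` -/
  | half (a : ZExpr)
  /-- `⌈a / b⌉` -/
  | ceilDiv (a b : ZExpr)

/-- Elementary instructions; the first argument is the register that is written. -/
inductive Instr
  | setZ (v : ZVar) (E : ZExpr)
  /-- `v := 1` over `R_e` -/
  | oneP (v : PVar)
  | copyP (v a : PVar)
  /-- `v := a * b` over `R_e` -/
  | mulP (v a b : PVar)
  /-- `v :=` remainder of `a` modulo `b` over `R_e` -/
  | remP (v a b : PVar)
  /-- `v :=` reduction of `a` modulo `p` -/
  | reduce (v : FVar) (a : PVar)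
  /-- `v := 1` over `R_1` -/
  | oneF (v : FVar)
  | copyF (v a : FVar)
  /-- `v := a * b` over `R_1` -/
  | mulF (v a b : FVar)
  /-- `v :=` quotient of `a` by `b` over `R_1` -/
  | quoF (v a b : FVar)
  /-- factor the content of the register `a` -/
  | factor (a : FVar)
  /-- go to the start of the list of factors -/
  | rewind
  /-- read the next pair `(G, k)` of the list into the registers `G` and `k` -/
  | next

/-- Tests. -/
inductive Test
  | leZ (a b : ZExpr)
  | oddZ (v : ZVar)
  | eqP (a b : PVar)
  /-- `g` divides `a` over `R_1` -/
  | dvdF (g a : FVar)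
  /-- the end of the list of factors has not been reached -/
  | more

/-- Programs. -/
inductive Prog
  | instr (i : Instr)
  | seq (c₁ c₂ : Prog)
  | ite (b : Test) (c₁ c₂ : Prog)
  | while (b : Test) (c : Prog)
  | skip

/-- Sequential composition of a list of programs. -/
def Prog.block : List Prog → Prog
  | [] => .skip
  | c :: cs => .seq c (Prog.block cs)

/-- States of the machine. -/
structure State (h : ℤ[X]) (p e : ℕ) where
  int : ZVar → ℤ
  poly : PVar → (GR h p e)[X]
  fpoly : FVar → (GR h p 1)[X]
  /-- the list of factors -/
  factors : List ((GR h p 1)[X] × ℕ)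
  /-- the part of the list that has not been read yet -/
  rest : List ((GR h p 1)[X] × ℕ)

section Semantics

variable {h : ℤ[X]} {p e : ℕ}

/-- The value of an integer expression. -/
def ZExpr.val (s : ZVar → ℤ) : ZExpr → ℤ
  | .var v => s v
  | .const a => a
  | .add a b => a.val s + b.val s
  | .sub a b => a.val s - b.val s
  | .mul a b => a.val s * b.val s
  | .half a => a.val s / 2
  | .ceilDiv a b => -((-a.val s) / b.val s)

/-- The effect of an instruction. -/
noncomputable def Instr.exec [NeZero e] (s : State h p e) : Instr → State h p e
  | .setZ v E => { s with int := Function.update s.int v (E.val s.int) }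
  | .oneP v => { s with poly := Function.update s.poly v 1 }
  | .copyP v a => { s with poly := Function.update s.poly v (s.poly a) }
  | .mulP v a b => { s with poly := Function.update s.poly v (s.poly a * s.poly b) }
  | .remP v a b => { s with poly := Function.update s.poly v (s.poly a %ₘ s.poly b) }
  | .reduce v a =>
      { s with fpoly := Function.update s.fpoly v ((s.poly a).map (residue h p e)) }
  | .oneF v => { s with fpoly := Function.update s.fpoly v 1 }
  | .copyF v a => { s with fpoly := Function.update s.fpoly v (s.fpoly a) }
  | .mulF v a b => { s with fpoly := Function.update s.fpoly v (s.fpoly a * s.fpoly b) }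
  | .quoF v a b => { s with fpoly := Function.update s.fpoly v (s.fpoly a /ₘ s.fpoly b) }
  | .factor a => { s with factors := factorList (s.fpoly a), rest := factorList (s.fpoly a) }
  | .rewind => { s with rest := s.factors }
  | .next =>
      match s.rest with
      | [] => s
      | (G, k) :: gs =>
        { s with
          fpoly := Function.update s.fpoly .G G
          int := Function.update s.int .k k
          rest := gs }

/-- The truth value of a test. -/
def Test.holds (s : State h p e) : Test → Prop
  | .leZ a b => a.val s.int ≤ b.val s.int
  | .oddZ v => Odd (s.int v)
  | .eqP a b => s.poly a = s.poly b
  | .dvdF g a => s.fpoly a %ₘ s.fpoly g = 0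
  | .more => s.rest ≠ []

end Semantics

/-! ### Running time

`M ε k` is the time for multiplying two polynomials of degree less than `k` over `R_ε`. The
constant `c` is the implied constant in the times of all other primitive operations. -/

/-- The conventions on multiplication times: at least one step, and monotone in both arguments. -/
structure IsMulTime (M : ℕ → ℕ → ℝ) : Prop where
  one_le : ∀ ε k, 1 ≤ ε → 1 ≤ k → 1 ≤ M ε k
  mono : ∀ ε ε' k k', 1 ≤ ε → ε ≤ ε' → 1 ≤ k → k ≤ k' → M ε k ≤ M ε' k'

/-- Number of bits (with sign) of an integer. -/
def bits (a : ℤ) : ℕ := a.natAbs.size + 1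

/-- Bound for the number of bits of an element of `R_ε`, where `|R_ε| = q ^ ε`, `q = p ^ deg h`. -/
def elemBits (h : ℤ[X]) (p ε : ℕ) : ℕ := ε * Nat.clog 2 (p ^ h.natDegree)

/-- Bound for the number of bits of a polynomial over `R_ε`. -/
noncomputable def polyBits (h : ℤ[X]) (p ε : ℕ) (a : (GR h p ε)[X]) : ℕ :=
  (a.natDegree + 1) * elemBits h p ε

/-- Time for multiplying two polynomials over `R_ε`. -/
noncomputable def mulTime (M : ℕ → ℕ → ℝ) {h : ℤ[X]} {p : ℕ} (ε : ℕ) (a b : (GR h p ε)[X]) : ℝ :=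
  M ε (max a.natDegree b.natDegree + 1)

/-- Time for the division with remainder of `a` by `b` over `R_ε`: up to the factor `c`, the time
for multiplying polynomials with as many coefficients as the quotient and the remainder have. -/
noncomputable def divTime (M : ℕ → ℕ → ℝ) (c : ℕ) {h : ℤ[X]} {p : ℕ} (ε : ℕ) (a b : (GR h p ε)[X]) : ℝ :=
  c * M ε (max (a.natDegree + 1 - b.natDegree) b.natDegree)

/-- Time for factoring `a` over `𝔽_q`: up to the factor `c`, it is `k * M 1 k * log (k * q)`, where
`k` is the number of coefficients of `a`. -/
noncomputable def factorTime (M : ℕ → ℕ → ℝ) (c : ℕ) {h : ℤ[X]} {p : ℕ} (a : (GR h p 1)[X]) : ℝ :=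
  c * ((a.natDegree + 1 : ℕ) * M 1 (a.natDegree + 1) *
    Real.log ((a.natDegree + 1 : ℕ) * (p : ℝ) ^ h.natDegree))

/-- Bit operations for evaluating an integer expression: linear for addition, subtraction and
halving, quadratic for multiplication and division. -/
def ZExpr.time (s : ZVar → ℤ) : ZExpr → ℕ
  | .var v => bits (s v)
  | .const a => bits a
  | .add a b => a.time s + b.time s + (bits (a.val s) + bits (b.val s))
  | .sub a b => a.time s + b.time s + (bits (a.val s) + bits (b.val s))
  | .mul a b => a.time s + b.time s + bits (a.val s) * bits (b.val s)
  | .half a => a.time s + bits (a.val s)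
  | .ceilDiv a b => a.time s + b.time s + bits (a.val s) * bits (b.val s)

section Times

variable {h : ℤ[X]} {p e : ℕ} (M : ℕ → ℕ → ℝ) (c : ℕ)

/-- The time of an instruction. -/
noncomputable def Instr.time (s : State h p e) : Instr → ℝ
  | .setZ _ E => c * E.time s.int
  | .oneP _ => c * polyBits h p e 1
  | .copyP _ a => c * polyBits h p e (s.poly a)
  | .mulP _ a b => mulTime M e (s.poly a) (s.poly b)
  | .remP _ a b => divTime M c e (s.poly a) (s.poly b)
  | .reduce _ a => c * (((s.poly a).natDegree + 1 : ℕ) * (elemBits h p e : ℝ) ^ 2)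
  | .oneF _ => c * polyBits h p 1 1
  | .copyF _ a => c * polyBits h p 1 (s.fpoly a)
  | .mulF _ a b => mulTime M 1 (s.fpoly a) (s.fpoly b)
  | .quoF _ a b => divTime M c 1 (s.fpoly a) (s.fpoly b)
  | .factor a => factorTime M c (s.fpoly a)
  | .rewind => c
  | .next =>
      match s.rest with
      | [] => c
      | (G, k) :: _ => c * (polyBits h p 1 G + bits k)

/-- The time of a test. -/
noncomputable def Test.time (s : State h p e) : Test → ℝ
  | .leZ a b => c * (a.time s.int + b.time s.int + (bits (a.val s.int) + bits (b.val s.int)))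
  | .oddZ _ => c
  | .eqP a b => c * (polyBits h p e (s.poly a) + polyBits h p e (s.poly b))
  | .dvdF g a => divTime M c 1 (s.fpoly a) (s.fpoly g)
  | .more => c

/-- `Runs M c P s s' t`: started in the state `s`, the program `P` halts in the state `s'` after
time `t`. At most one pair `(s', t)` is possible for given `P` and `s`. -/
inductive Runs [NeZero e] : Prog → State h p e → State h p e → ℝ → Prop
  | instr (i : Instr) (s : State h p e) : Runs (.instr i) s (i.exec s) (i.time M c s)
  | seq {c₁ c₂ : Prog} {s₀ s₁ s₂ : State h p e} {t₁ t₂ : ℝ} :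
      Runs c₁ s₀ s₁ t₁ → Runs c₂ s₁ s₂ t₂ → Runs (.seq c₁ c₂) s₀ s₂ (t₁ + t₂)
  | ite_true {b : Test} {c₁ c₂ : Prog} {s s' : State h p e} {t : ℝ} :
      b.holds s → Runs c₁ s s' t → Runs (.ite b c₁ c₂) s s' (b.time M c s + t)
  | ite_false {b : Test} {c₁ c₂ : Prog} {s s' : State h p e} {t : ℝ} :
      ¬ b.holds s → Runs c₂ s s' t → Runs (.ite b c₁ c₂) s s' (b.time M c s + t)
  | while_true {b : Test} {c₁ : Prog} {s₀ s₁ s₂ : State h p e} {t₁ t₂ : ℝ} :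
      b.holds s₀ → Runs c₁ s₀ s₁ t₁ → Runs (.while b c₁) s₁ s₂ t₂ →
      Runs (.while b c₁) s₀ s₂ (b.time M c s₀ + t₁ + t₂)
  | while_false {b : Test} {c₁ : Prog} {s : State h p e} :
      ¬ b.holds s → Runs (.while b c₁) s s (b.time M c s)
  | skip (s : State h p e) : Runs .skip s s 0

end Times

/-! ### The algorithm

Input: `f` and `m` over `R_e` in the registers `f` and `m`, the exponent `e` and the maximal cycle
length in the registers `e` and `ellMax`. Output: the register `out`. -/

/-- `dst := f ^ E rem m` by square-and-multiply. -/
def powMod (dst : PVar) (E : ZExpr) : Prog := .block [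
  .instr (.setZ .x E),
  .instr (.copyP .base .f),
  .instr (.oneP dst),
  .while (.leZ (.const 1) (.var .x)) (.block [
    .ite (.oddZ .x)
      (.block [.instr (.mulP dst dst .base), .instr (.remP dst dst .m)])
      .skip,
    .instr (.mulP .base .base .base),
    .instr (.remP .base .base .m),
    .instr (.setZ .x (.half (.var .x)))])]

/-- Compute both sides of `f ^ (h + ellMax) ≡ f ^ h (mod m)`. -/
def bothSides : Prog := .block [
  powMod .lhs (.add (.var .h) (.var .ellMax)),
  powMod .rhs (.var .h)]

/-- The decomposition `m = M1 * M2` over `R_1`: all prime factors of `F` are moved from `M1` to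
`M2`, so that `M1` is the greatest monic divisor of `m` coprime to `F`. -/
def decompose : Prog := .block [
  .instr (.reduce .M1 .m),
  .instr (.oneF .M2),
  .instr .rewind,
  .while .more (.block [
    .instr .next,
    .while (.dvdF .G .M1) (.block [
      .instr (.quoF .M1 .M1 .G),
      .instr (.mulF .M2 .M2 .G)])])]

/-- `tau` is the maximum of `⌈κ_G(M2) / κ_G(F)⌉` over the prime factors `G` of `F`. -/
def fieldHeight : Prog := .block [
  .instr (.setZ .tau (.const 0)),
  .instr .rewind,
  .while .more (.block [
    .instr .next,
    .instr (.copyF .A .M2),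
    .instr (.setZ .kappa (.const 0)),
    .while (.dvdF .G .A) (.block [
      .instr (.quoF .A .A .G),
      .instr (.setZ .kappa (.add (.var .kappa) (.const 1)))]),
    .instr (.setZ .ratio (.ceilDiv (.var .kappa) (.var .k))),
    .ite (.leZ (.var .ratio) (.var .tau)) .skip (.instr (.setZ .tau (.var .ratio)))])]

/-- Binary search for the height in the interval from `tau` to `e * tau`. -/
def heightAlgorithm : Prog := .block [
  .instr (.reduce .F .f),
  .instr (.factor .F),
  decompose,
  fieldHeight,
  .instr (.setZ .r (.mul (.var .e) (.var .tau))),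
  .instr (.setZ .l (.var .tau)),
  .while (.leZ (.var .l) (.var .r)) (.block [
    .instr (.setZ .h (.add (.var .l) (.half (.sub (.var .r) (.var .l))))),
    bothSides,
    .ite (.eqP .lhs .rhs)
      (.instr (.setZ .r (.sub (.var .h) (.const 1))))
      (.instr (.setZ .l (.add (.var .h) (.const 1))))]),
  bothSides,
  .ite (.eqP .lhs .rhs)
    (.instr (.setZ .out (.var .h)))
    (.instr (.setZ .out (.add (.var .h) (.const 1))))]

end GaloisHeight

open GaloisHeight

namespace GaloisHeight

/-! ### Multiplication maps on finite commutative rings -/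

section MulDynamics

variable {A : Type*} [CommRing A]

/-! Let `A` be the quotient $R_e[x]/(m)$ and `a` the class of `f` in it, so that $\Gamma^k x = a^k
x$. An equation $a^{k+\ell}=a^k$, multiplied by `x`, holds along the orbit of every `x`; hence the
orbit of `1` is the extremal one. The height `H` is the preperiod of `1`, the largest cycle length
`L` is the period of `1`, and $a^{k+L}=a^k$ holds exactly when $k\ge H$
(`exists_isSystemHeight_mul`). The test of the algorithm thus decides $H\le h$, and binary search
finds `H` once $\tau\le H\le e\tau$ is known (`height_mem_Icc`).

Lower bound: reduce $m\mid f^H(f^L-1)$ modulo `p`. An irreducible $G\mid F$ is coprime to $F^L-1$,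
so $\kappa_G(\bar m)\le H\kappa_G(F)$, which forces $\tau\le H$. Upper bound: modulo `p` the
exponent `H` may be lowered to $\tau$, because an irreducible not dividing `F` is insensitive to
powers of `F` (`dvd_pow_mul_of_multiplicity_le`). The `e`-th power of this divisibility holds modulo
$p^e$ (`proj_dvd_pow`), so $a^{e\tau}(a^L-1)^e=0$. Since `a` and $a^L-1$ are comaximal, the factor
$(a^L-1)^e$ can be traded for some $a^{L'}-1$ (`exists_pow_add_eq_of_nilpotent`).

Running time: let `lam` be the bit size of $neq$ and $D=(c+1)\mathcal M_e(n)$, a bound for one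
polynomial operation. As $L\le|A|\le q^{en}$, all exponents have at most $S=2ne\cdot$`lam` bits. A
modular power takes at most `S` rounds, each with boundedly many operations of time `D` and $O(S)$
bit operations on the exponent, so $O(S^2D)$. At most `lam` rounds of the search give
$O(n^2e^2\,$`lam`$^3D)$, which dominates the work over $\mathbb F_q$. Correctness and time are
carried together by the triples `RunsWithin`, with an invariant and a variant for each loop. -/

theorem iterate_mul_left_apply (a x : A) (k : ℕ) : (fun g => a * g)^[k] x = a ^ k * x := by
  induction k with
  | zero => simp
  | succ k ih => rw [Function.iterate_succ_apply', ih, pow_succ]; ring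

theorem exists_pow_add_eq [Finite A] (a : A) : ∃ k ℓ, 0 < ℓ ∧ a ^ (k + ℓ) = a ^ k := by
  obtain ⟨i, j, hij, h⟩ := Finite.exists_ne_map_eq_of_infinite (fun k : ℕ => a ^ k)
  rcases lt_or_gt_of_ne hij with h' | h'
  · exact ⟨i, j - i, by omega, by rw [Nat.add_sub_cancel' h'.le]; exact h.symm⟩
  · exact ⟨j, i - j, by omega, by rw [Nat.add_sub_cancel' h'.le]; exact h⟩

theorem pow_add_eq_of_le {a : A} {k ℓ j : ℕ} (h : a ^ (k + ℓ) = a ^ k) (hj : k ≤ j) :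
    a ^ (j + ℓ) = a ^ j := by
  obtain ⟨i, rfl⟩ := Nat.exists_eq_add_of_le hj
  rw [show k + i + ℓ = k + ℓ + i by ring, pow_add, h, ← pow_add]

/-- The height of the multiplication by `a` is the preperiod of `1`, the maximal cycle length is the
period of `1`, and both are characterised by the equations between powers of `a`. -/
theorem exists_isSystemHeight_mul [Finite A] {a : A} {Γ : A → A} (hΓ : ∀ g, Γ g = a * g) {L : ℕ}
    (hL : IsGreatest (cycleLengths Γ) L) :
    ∃ H, IsSystemHeight Γ H ∧ 0 < L ∧ L ≤ Nat.card A ∧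
      (∀ k, a ^ (k + L) = a ^ k ↔ H ≤ k) ∧
      ∀ k ℓ, 0 < ℓ → a ^ (k + ℓ) = a ^ k → H ≤ k := by
  have hit : ∀ k x, Γ^[k] x = a ^ k * x := fun k x => by
    rw [funext hΓ]; exact iterate_mul_left_apply a x k
  set H := preperiod Γ 1 with hH
  have hHne : {τ | ∃ ℓ, 0 < ℓ ∧ Γ^[τ + ℓ] 1 = Γ^[τ] 1}.Nonempty := by
    obtain ⟨k, ℓ, h0, h⟩ := exists_pow_add_eq a
    exact ⟨k, ℓ, h0, by simpa [hit] using h⟩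
  have hHmem : ∃ ℓ, 0 < ℓ ∧ a ^ (H + ℓ) = a ^ H := by
    have h : ∃ ℓ, 0 < ℓ ∧ Γ^[H + ℓ] 1 = Γ^[H] 1 := Nat.sInf_mem hHne
    simpa only [hit, mul_one] using h
  have hHmin : ∀ k ℓ, 0 < ℓ → a ^ (k + ℓ) = a ^ k → H ≤ k := fun k ℓ h0 h =>
    Nat.sInf_le ⟨ℓ, h0, by simpa [hit] using h⟩
  set P := period Γ 1 with hP
  have hPmem : 0 < P ∧ a ^ (H + P) = a ^ H := by
    have : {ℓ | 0 < ℓ ∧ Γ^[preperiod Γ 1 + ℓ] 1 = Γ^[preperiod Γ 1] 1}.Nonempty := by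
      obtain ⟨ℓ, h0, h⟩ := hHmem
      exact ⟨ℓ, h0, by simpa [hit, ← hH] using h⟩
    have h : 0 < P ∧ Γ^[H + P] 1 = Γ^[H] 1 := Nat.sInf_mem this
    simpa only [hit, mul_one] using h
  have hPmin : ∀ ℓ, 0 < ℓ → a ^ (H + ℓ) = a ^ H → P ≤ ℓ := fun ℓ h0 h =>
    Nat.sInf_le ⟨h0, by simpa [hit, ← hH] using h⟩
  have hper : ∀ x, period Γ x ≤ P := by
    intro x
    set t := preperiod Γ x with ht
    have hne : {τ | ∃ ℓ, 0 < ℓ ∧ Γ^[τ + ℓ] x = Γ^[τ] x}.Nonempty :=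
      ⟨H, P, hPmem.1, by simp [hit, hPmem.2]⟩
    obtain ⟨ℓ, h0, h⟩ : ∃ ℓ, 0 < ℓ ∧ Γ^[t + ℓ] x = Γ^[t] x := Nat.sInf_mem hne
    rw [hit, hit] at h
    -- Moving `H` periods ahead from `t` reaches an exponent at least `H`, where `P` is a period of
    -- the powers of `a`. So `P` is a return time of `x` already at its own preperiod.
    have hj : ∀ j, a ^ (t + j * ℓ) * x = a ^ t * x := by
      intro j
      induction j with
      | zero => simp
      | succ j ih =>
        rw [show t + (j + 1) * ℓ = j * ℓ + (t + ℓ) by ring, pow_add, mul_assoc, h, ← mul_assoc,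
          ← pow_add, add_comm, ih]
    refine Nat.sInf_le ⟨hPmem.1, ?_⟩
    rw [← ht, hit, hit]
    have hge : H ≤ t + H * ℓ := le_add_left (Nat.le_mul_of_pos_right _ h0)
    calc a ^ (t + P) * x = a ^ P * (a ^ (t + H * ℓ) * x) := by rw [hj]; ring
      _ = a ^ (t + H * ℓ + P) * x := by ring
      _ = a ^ t * x := by rw [pow_add_eq_of_le hPmem.2 hge, hj]
  have hLP : L = P := by
    refine le_antisymm ?_ (hL.2 ⟨1, rfl⟩)
    obtain ⟨x, rfl⟩ := hL.1
    exact hper x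
  have hmemP : ∀ x, Γ^[H] x ∈ Function.periodicPts Γ := fun x =>
    ⟨P, hPmem.1, by
      rw [Function.IsPeriodicPt, Function.IsFixedPt, hit, hit, ← mul_assoc, ← pow_add, add_comm,
        hPmem.2]⟩
  have hnot : ∀ j < H, Γ^[j] 1 ∉ Function.periodicPts Γ := by
    rintro j hj ⟨ℓ, h0, h⟩
    rw [Function.IsPeriodicPt, Function.IsFixedPt, hit, hit, ← mul_assoc, ← pow_add, add_comm,
      mul_one, mul_one] at h
    exact absurd (hHmin j ℓ h0 h) (by omega)
  refine ⟨H, ?_, hLP ▸ hPmem.1, ?_, ?_, hHmin⟩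
  -- After `H` steps every point lies on a cycle, so no tree path has more than `H` edges. The path
  -- starting at `1` attains this bound.
  · have hle : ∀ {c : A} {k : ℕ}, (∃ x, IsLeaf Γ x ∧ TreePath Γ c x k) → k ≤ H := by
      rintro c k ⟨x, -, -, hx⟩
      by_contra hk
      exact hx H (by omega) (hmemP x)
    refine ⟨⟨Γ^[H] 1, hmemP 1, ⟨1, ?_, rfl, hnot⟩, fun k hk => hle hk⟩, ?_⟩
    -- If `H > 0`, then `1` has no predecessor at all: from a predecessor, `H` steps would lead to a
    -- cycle, but they end at the point `H - 1` steps after `1`.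
    · intro y hy
      rcases Nat.eq_zero_or_pos H with h0 | h0
      · simpa [h0] using hmemP y
      · refine absurd (hmemP y) ?_
        obtain ⟨j, hj⟩ := Nat.exists_eq_succ_of_ne_zero h0.ne'
        rw [hj, Function.iterate_succ_apply, hy]
        exact hnot j (by omega)
    · rintro t ⟨c, -, ht⟩
      exact hle ht.1
  -- The powers $a^H,\dots,a^{H+L-1}$ are distinct, whence $L\le|A|$. This later bounds the bit
  -- length of the exponents.
  · have hinj : Function.Injective fun i : Fin L => a ^ (H + i) := by
      have key : ∀ i j : ℕ, i < j → j < L → a ^ (H + i) ≠ a ^ (H + j) := by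
        intro i j hij hjL h
        have := hPmin (j - i) (by omega) ?_
        · omega
        · have e1 : a ^ (H + P) * a ^ (j - i) = a ^ (H + P) := by
            rw [← pow_add, show H + P + (j - i) = (H + j) + (P - i) by omega, pow_add, ← h,
              ← pow_add]
            congr 1; omega
          rwa [hPmem.2, ← pow_add] at e1
      intro i j h
      rcases lt_trichotomy (i : ℕ) j with h' | h' | h'
      · exact absurd h (key _ _ h' j.2)
      · exact Fin.ext h'
      · exact absurd h.symm (key _ _ h' i.2)
    simpa using Nat.card_le_card_of_injective _ hinj
  · intro k
    refine ⟨fun h => hHmin k L (hLP ▸ hPmem.1) h, fun h => hLP ▸ pow_add_eq_of_le hPmem.2 h⟩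

end MulDynamics

/-- If `a ^ k * (a ^ ℓ - 1)` is nilpotent, then in a finite ring the preperiod of the powers of `a`
is bounded. -/
theorem exists_pow_add_eq_of_nilpotent {A : Type*} [CommRing A] [Finite A] {a : A} {k ℓ e : ℕ}
    (hℓ : 0 < ℓ) (h : (a ^ k * (a ^ ℓ - 1)) ^ e = 0) :
    ∃ L, 0 < L ∧ a ^ (e * k + L) = a ^ (e * k) := by
  obtain ⟨N, L, h0, hL⟩ := exists_pow_add_eq a
  refine ⟨L, h0, ?_⟩
  -- Comaximality comes from $a^{\ell-1}a-(a^\ell-1)=1$. Multiplying $a^{ek}(a^L-1)$ by the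
  -- resulting expression for `1` leaves one term killed by $a^N(a^L-1)=0$ and one killed by `h`.
  have hcop : IsCoprime (a ^ N) ((a ^ ℓ - 1) ^ e) := by
    apply IsCoprime.pow
    refine ⟨a ^ (ℓ - 1), -1, ?_⟩
    rw [← pow_succ, Nat.sub_add_cancel hℓ]; ring
  obtain ⟨α, β, hαβ⟩ := hcop
  rw [mul_pow, ← pow_mul, mul_comm k e] at h
  have hL' : a ^ N * (a ^ L - 1) = 0 := by rw [mul_sub, ← pow_add, hL]; ring
  have : a ^ (e * k) * (a ^ L - 1) = 0 := by
    calc a ^ (e * k) * (a ^ L - 1)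
        = a ^ (e * k) * (a ^ L - 1) * (α * a ^ N + β * (a ^ ℓ - 1) ^ e) := by rw [hαβ, mul_one]
      _ = a ^ (e * k) * α * (a ^ N * (a ^ L - 1))
          + β * (a ^ L - 1) * (a ^ (e * k) * (a ^ ℓ - 1) ^ e) := by ring
      _ = 0 := by rw [hL', h]; ring
  rw [pow_add]; linear_combination this

/-! ### Multiplicities over a field -/

section FieldPoly

variable {K : Type*} [CommRing K]

theorem dvd_pow_of_multiplicity_le {D : Type*} [CommRing D] [IsDomain D]
    [UniqueFactorizationMonoid D] {G F m : D} (hG : Prime G)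
    {k i : ℕ} (h : multiplicity G m ≤ k * multiplicity G F) (hm : m ≠ 0)
    (hi : G ^ i ∣ m) : G ^ i ∣ F ^ k := by
  have fm := FiniteMultiplicity.of_prime_left hG hm
  have : i ≤ multiplicity G m := fm.le_multiplicity_of_pow_dvd hi
  refine (pow_dvd_pow _ (this.trans h)).trans ?_
  rw [mul_comm, pow_mul]
  exact pow_dvd_pow_of_dvd (pow_multiplicity_dvd _ _) _

/-- Lowering the exponent of `F` in `m ∣ F ^ N * (F ^ ℓ - 1)`. -/
theorem dvd_pow_mul_of_multiplicity_le (hK : IsField K) {F m : K[X]} (hm : m ≠ 0)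
    {N ℓ k : ℕ} (h : m ∣ F ^ N * (F ^ ℓ - 1))
    (hk : ∀ G : K[X], G.Monic → Irreducible G → G ∣ F → multiplicity G m ≤ k * multiplicity G F) :
    m ∣ F ^ k * (F ^ ℓ - 1) := by
  let := hK.toField
  rw [UniqueFactorizationMonoid.dvd_iff_emultiplicity_le hm]
  intro P hP
  classical
  -- The hypothesis speaks of monic divisors only, so the prime is replaced by its monic associate.
  set G := normalize P with hGdef
  have hassoc : Associated P G := associated_normalize P
  have hGp : Prime G := hassoc.prime hP
  rw [emultiplicity_eq_of_associated_left hassoc.symm, emultiplicity_eq_of_associated_left hassoc.symm]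
  refine emultiplicity_le_emultiplicity_iff.2 fun i hi => ?_
  by_cases hGF : G ∣ F
  · exact (dvd_pow_of_multiplicity_le hGp
      (hk G (monic_normalize hP.ne_zero) hGp.irreducible hGF) hm hi).mul_right _
  · have hcop : IsCoprime (G ^ i) (F ^ N) := by
      apply IsCoprime.pow
      exact (hGp.irreducible.coprime_iff_not_dvd).2 hGF
    exact (hcop.dvd_of_dvd_mul_left (hi.trans h)).mul_left _

/-- If `m ∣ F ^ k * (F ^ ℓ - 1)`, then `k` bounds the ratios of the multiplicities. -/
theorem multiplicity_le_of_dvd_pow_mul (hK : IsField K) {F m G : K[X]} (hF : F ≠ 0)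
    {k ℓ : ℕ} (hℓ : 0 < ℓ) (h : m ∣ F ^ k * (F ^ ℓ - 1)) (hG : Irreducible G) (hGF : G ∣ F) :
    multiplicity G m ≤ k * multiplicity G F := by
  let := hK.toField
  have hGp := hG.prime
  have hcop : IsCoprime (G ^ multiplicity G m) (F ^ ℓ - 1) := by
    apply IsCoprime.pow_left
    -- `G` divides $F^\ell$ because $\ell>0$, hence it is coprime to $F^\ell-1$; the Bézout
    -- coefficients are explicit.
    obtain ⟨D, rfl⟩ := hGF
    refine ⟨D * (G * D) ^ (ℓ - 1), -1, ?_⟩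
    obtain ⟨j, rfl⟩ := Nat.exists_eq_succ_of_ne_zero hℓ.ne'
    simp only [Nat.succ_eq_add_one, Nat.add_sub_cancel]; ring
  have hd : G ^ multiplicity G m ∣ F ^ k :=
    hcop.dvd_of_dvd_mul_right ((pow_multiplicity_dvd G m).trans h)
  have hf := FiniteMultiplicity.of_prime_left hGp (pow_ne_zero k hF)
  have := hf.le_multiplicity_of_pow_dvd hd
  rwa [FiniteMultiplicity.multiplicity_pow hGp (FiniteMultiplicity.of_prime_left hGp hF)] at this

theorem finite_setOf_monic_irreducible_dvd (hK : IsField K) {F : K[X]} (hF : F ≠ 0) :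
    {G : K[X] | G.Monic ∧ Irreducible G ∧ G ∣ F}.Finite := by
  let := hK.toField
  classical
  refine (UniqueFactorizationMonoid.normalizedFactors F).toFinset.finite_toSet.subset ?_
  rintro G ⟨h1, h2, h3⟩
  simp only [Finset.mem_coe, Multiset.mem_toFinset]
  exact (UniqueFactorizationMonoid.mem_normalizedFactors_iff' hF).2 ⟨h2, h1.normalize_eq_self, h3⟩

/-- The entries of the list of factors. -/
theorem mem_factorList_iff (hK : IsField K) {F : K[X]} (hF : F ≠ 0) (x : K[X] × ℕ) :
    x ∈ factorList F ↔
      (x.1.Monic ∧ Irreducible x.1 ∧ x.1 ∣ F) ∧ x.2 = multiplicity x.1 F := by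
  rw [factorList, dif_pos (finite_setOf_monic_irreducible_dvd hK hF)]
  obtain ⟨G, k⟩ := x
  simp only [List.mem_map, Finset.mem_toList, Set.Finite.mem_toFinset, Set.mem_ofPred_eq,
    Prod.mk.injEq]
  constructor
  · rintro ⟨G', h, rfl, rfl⟩; exact ⟨h, rfl⟩
  · rintro ⟨h, rfl⟩; exact ⟨G, h, rfl, rfl⟩

/-- Distinct monic irreducible divisors are pairwise coprime, so their product divides `F`, and each
contributes at least one to the degree. -/
theorem length_factorList_le (hK : IsField K) {F : K[X]} (hF : F ≠ 0) :
    (factorList F).length ≤ F.natDegree := by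
  let := hK.toField
  rw [factorList, dif_pos (finite_setOf_monic_irreducible_dvd hK hF)]
  set S := (finite_setOf_monic_irreducible_dvd hK hF).toFinset with hS
  have hmem : ∀ G ∈ S, G.Monic ∧ Irreducible G ∧ G ∣ F := by simp [hS]
  rw [List.length_map, Finset.length_toList]
  have hdvd : ∏ G ∈ S, G ∣ F := by
    apply Finset.prod_dvd_of_coprime
    · intro G hG G' hG' hne
      obtain ⟨a1, a2, -⟩ := hmem G hG
      obtain ⟨b1, b2, -⟩ := hmem G' hG'
      refine (a2.coprime_iff_not_dvd).2 fun hd => hne ?_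
      exact eq_of_monic_of_associated a1 b1 ((a2.dvd_irreducible_iff_associated b2).1 hd)
    · exact fun G hG => (hmem G hG).2.2
  calc S.card = ∑ G ∈ S, 1 := by simp
    _ ≤ ∑ G ∈ S, G.natDegree := Finset.sum_le_sum fun G hG => (hmem G hG).2.1.natDegree_pos
    _ = (∏ G ∈ S, G).natDegree := (natDegree_prod_of_monic _ _ fun G hG => (hmem G hG).1).symm
    _ ≤ F.natDegree := natDegree_le_of_dvd hdvd hF

end FieldPoly

/-! ### Galois rings -/

section GaloisRing

variable {h : ℤ[X]} {p e : ℕ}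

/-- The ring `R_e` is a quotient of `(ℤ / p ^ e)[t] / (h)`. -/
theorem exists_adjoinRoot_surjective (h : ℤ[X]) (p e : ℕ) :
    ∃ φ : AdjoinRoot (h.map (Int.castRingHom (ZMod (p ^ e)))) →+* GR h p e,
      Function.Surjective φ := by
  have hp : (((p ^ e : ℕ) : ℤ) : GR h p e) = 0 := by
    have : (Ideal.Quotient.mk (Ideal.span {((p : AdjoinRoot h)) ^ e})) ((p : AdjoinRoot h) ^ e) = 0 :=
      Ideal.Quotient.eq_zero_iff_mem.2 (Ideal.mem_span_singleton_self _)
    rw [← this]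
    push_cast
    rw [map_pow, map_natCast]
  have hchar : CharP (GR h p e) (ringChar (GR h p e)) := ringChar.charP _
  -- The characteristic divides $p^e$, which is all that is needed for a ring homomorphism from
  -- `ZMod (p ^ e)`.
  have hdvd : ringChar (GR h p e) ∣ p ^ e :=
    (CharP.cast_eq_zero_iff (GR h p e) _ _).1 (by exact_mod_cast hp)
  let ψ : ZMod (p ^ e) →+* GR h p e := ZMod.castHom hdvd _
  let x : GR h p e := Ideal.Quotient.mk _ (AdjoinRoot.root h)
  have hψ : ψ.comp (Int.castRingHom (ZMod (p ^ e))) =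
      (Ideal.Quotient.mk (Ideal.span {((p : AdjoinRoot h)) ^ e})).comp (AdjoinRoot.of h) :=
    RingHom.ext_int _ _
  have hx : (h.map (Int.castRingHom (ZMod (p ^ e)))).eval₂ ψ x = 0 := by
    rw [eval₂_map, hψ, ← hom_eval₂, AdjoinRoot.eval₂_root, map_zero]
  refine ⟨AdjoinRoot.lift ψ x hx, fun y => ?_⟩
  obtain ⟨y, rfl⟩ := Ideal.Quotient.mk_surjective y
  obtain ⟨g, rfl⟩ := AdjoinRoot.mk_surjective y
  refine ⟨AdjoinRoot.mk _ (g.map (Int.castRingHom (ZMod (p ^ e)))), ?_⟩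
  rw [AdjoinRoot.lift_mk, eval₂_map, hψ, ← hom_eval₂, ← AdjoinRoot.aeval_eq, aeval_def]
  rfl

theorem card_adjoinRoot {S : Type*} [CommRing S] [Finite S] {g : S[X]} (hg : g.Monic) :
    Finite (AdjoinRoot g) ∧ Nat.card (AdjoinRoot g) = Nat.card S ^ g.natDegree := by
  have b := (AdjoinRoot.powerBasis' hg).basis.equivFun
  have hd : (AdjoinRoot.powerBasis' hg).dim = g.natDegree := AdjoinRoot.powerBasis'_dim hg
  refine ⟨Finite.of_equiv _ b.toEquiv.symm, ?_⟩
  rw [Nat.card_congr b.toEquiv, Nat.card_fun, Nat.card_eq_fintype_card (α := Fin _), Fintype.card_fin, hd]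

theorem card_GR_le (hp : p.Prime) (hh : h.Monic) :
    Finite (GR h p e) ∧ Nat.card (GR h p e) ≤ (p ^ h.natDegree) ^ e := by
  have : NeZero (p ^ e) := ⟨pow_ne_zero _ hp.ne_zero⟩
  obtain ⟨φ, hφ⟩ := exists_adjoinRoot_surjective h p e
  obtain ⟨h1, h2⟩ := card_adjoinRoot (hh.map (Int.castRingHom (ZMod (p ^ e))))
  refine ⟨Finite.of_surjective _ hφ, (Nat.card_le_card_of_surjective _ hφ).trans ?_⟩
  rw [h2, Nat.card_zmod, ← pow_mul, ← pow_mul, mul_comm e]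
  exact Nat.pow_le_pow_right hp.pos (Nat.mul_le_mul_right _ natDegree_map_le)

/-- An upper bound suffices, since the cardinality is used only to bound `ellMax`; a surjection onto
`R_e` is therefore enough. -/
theorem card_quotient_le (hp : p.Prime) (hh : h.Monic) {g : (GR h p e)[X]} (hg : g.Monic) :
    Finite ((GR h p e)[X] ⧸ Ideal.span {g}) ∧
      Nat.card ((GR h p e)[X] ⧸ Ideal.span {g}) ≤ (p ^ h.natDegree) ^ (e * g.natDegree) := by
  obtain ⟨h1, h2⟩ := card_GR_le (e := e) hp hh
  obtain ⟨h3, h4⟩ := card_adjoinRoot hg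
  refine ⟨h3, ?_⟩
  rw [pow_mul]
  exact h4.le.trans (Nat.pow_le_pow_left h2 _)

/-- The map from $R$ to the nonzero ring $\mathbb F_p[t]/(\bar h)$ kills `p`, so `p` generates a
proper ideal. -/
theorem nontrivial_GR_one (hirr : Irreducible (h.map (Int.castRingHom (ZMod p)))) :
    Nontrivial (GR h p 1) := by
  have hnt : Nontrivial (AdjoinRoot (h.map (Int.castRingHom (ZMod p)))) :=
    Ideal.Quotient.nontrivial_iff.2 (by
      rw [Ne, Ideal.span_singleton_eq_top]; exact hirr.not_isUnit)
  let φ : AdjoinRoot h →+* AdjoinRoot (h.map (Int.castRingHom (ZMod p))) :=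
    AdjoinRoot.map (Int.castRingHom (ZMod p)) h _ dvd_rfl
  refine Ideal.Quotient.nontrivial_iff.2 fun htop => ?_
  have hle : Ideal.span {(p : AdjoinRoot h) ^ 1} ≤ RingHom.ker φ := by
    rw [Ideal.span_singleton_le_iff_mem, RingHom.mem_ker, pow_one, map_natCast]
    have : ((p : ZMod p)) = 0 := by simp
    rw [← map_natCast (AdjoinRoot.of (h.map (Int.castRingHom (ZMod p)))), this, map_zero]
  rw [htop, top_le_iff] at hle
  exact RingHom.ker_ne_top φ hle

/-- A surjection from the field $\mathbb F_p[t]/(\bar h)$ onto a nontrivial ring is an isomorphism.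
-/
theorem isField_GR_one (hp : p.Prime) (hirr : Irreducible (h.map (Int.castRingHom (ZMod p)))) :
    IsField (GR h p 1) := by
  have hnt := nontrivial_GR_one hirr
  obtain ⟨φ, hφ⟩ := exists_adjoinRoot_surjective h p 1
  have hp1 : (p ^ 1).Prime := by simpa using hp
  have hirr1 : Irreducible (h.map (Int.castRingHom (ZMod (p ^ 1)))) := by
    rw [pow_one]; exact hirr
  have : Fact (p ^ 1).Prime := ⟨hp1⟩
  have : Fact (Irreducible (h.map (Int.castRingHom (ZMod (p ^ 1))))) := ⟨hirr1⟩
  let E := RingEquiv.ofBijective φ ⟨φ.injective, hφ⟩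
  exact E.symm.toMulEquiv.isField (Field.toIsField _)

theorem nontrivial_GR [NeZero e] (hirr : Irreducible (h.map (Int.castRingHom (ZMod p)))) :
    Nontrivial (GR h p e) := by
  have := nontrivial_GR_one hirr
  exact (residue h p e).domain_nontrivial

theorem map_residue_proj [NeZero e] (g : (AdjoinRoot h)[X]) :
    (proj h p e g).map (residue h p e) = proj h p 1 g := by
  rw [proj, proj, Polynomial.map_map]
  rfl

/-- Divisibility modulo `p` lifts to a divisibility of the `e`-th power modulo `p ^ e`. -/
theorem proj_dvd_pow {m g : (AdjoinRoot h)[X]} (hd : proj h p 1 m ∣ proj h p 1 g) :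
    proj h p e m ∣ proj h p e g ^ e := by
  obtain ⟨b, hb⟩ := hd
  obtain ⟨b, rfl⟩ := Polynomial.map_surjective _ Ideal.Quotient.mk_surjective b
  have h0 : (g - m * b).map (Ideal.Quotient.mk (Ideal.span {(p : AdjoinRoot h) ^ 1})) = 0 := by
    rw [Polynomial.map_sub, Polynomial.map_mul, sub_eq_zero]; exact hb
  have hC : C (p : AdjoinRoot h) ∣ g - m * b := by
    rw [C_dvd_iff_dvd_coeff]
    intro i
    have := congrArg (fun q => q.coeff i) h0
    simp only [coeff_map, coeff_zero] at this
    rw [Ideal.Quotient.eq_zero_iff_mem, Ideal.mem_span_singleton, pow_one] at this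
    exact this
  obtain ⟨r, hr⟩ := hC
  have hg : g = m * b + C (p : AdjoinRoot h) * r := by rw [← hr]; ring
  have hpe : proj h p e (C (p : AdjoinRoot h) * r) ^ e = 0 := by
    rw [proj, ← Polynomial.map_pow, mul_pow, ← C_pow, Polynomial.map_mul, map_C,
      Ideal.Quotient.eq_zero_iff_mem.2 (Ideal.mem_span_singleton_self _), C_0, zero_mul]
  have hsplit : proj h p e g =
      proj h p e m * proj h p e b + proj h p e (C (p : AdjoinRoot h) * r) := by
    conv_lhs => rw [hg]
    simp only [proj, Polynomial.map_add, Polynomial.map_mul]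
  rw [hsplit]
  -- Here $g=mb+pr$ and $(pr)^e=0$ over $R_e$, so $mb=g-pr$ divides $g^e-(pr)^e=g^e$.
  have := sub_dvd_pow_sub_pow (proj h p e m * proj h p e b + proj h p e (C (p : AdjoinRoot h) * r))
    (proj h p e (C (p : AdjoinRoot h) * r)) e
  rw [hpe, sub_zero, add_sub_cancel_right] at this
  exact (dvd_mul_right _ _).trans this

/-- The bounds for the height in terms of the factorization modulo `p`. -/
theorem height_mem_Icc [NeZero e] (hp : p.Prime) (hh : h.Monic)
    (hirr : Irreducible (h.map (Int.castRingHom (ZMod p)))) {f m : (AdjoinRoot h)[X]}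
    (hf : f.Monic) (hm : m.Monic) {H L τ : ℕ} (hL0 : 0 < L)
    (hL : ∀ k, (Ideal.Quotient.mk (Ideal.span {proj h p e m}) (proj h p e f)) ^ (k + L) =
      (Ideal.Quotient.mk (Ideal.span {proj h p e m}) (proj h p e f)) ^ k ↔ H ≤ k)
    (hH : ∀ k ℓ, 0 < ℓ → (Ideal.Quotient.mk (Ideal.span {proj h p e m}) (proj h p e f)) ^ (k + ℓ) =
      (Ideal.Quotient.mk (Ideal.span {proj h p e m}) (proj h p e f)) ^ k → H ≤ k)
    (hτ : ∀ k, τ ≤ k ↔ ∀ G : (GR h p 1)[X], G.Monic → Irreducible G → G ∣ proj h p 1 f →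
      multiplicity G (proj h p 1 m) ≤ k * multiplicity G (proj h p 1 f)) :
    τ ≤ H ∧ H ≤ e * τ := by
  have hK := isField_GR_one hp hirr
  have hnt := nontrivial_GR_one hirr
  have hF0 : proj h p 1 f ≠ 0 := (hf.map _).ne_zero
  have hm0 : proj h p 1 m ≠ 0 := (hm.map _).ne_zero
  have hdvd : proj h p 1 m ∣ proj h p 1 f ^ H * (proj h p 1 f ^ L - 1) := by
    have h1 := (hL H).2 le_rfl
    rw [← map_pow, ← map_pow, Ideal.Quotient.eq, Ideal.mem_span_singleton] at h1
    have h2 := Polynomial.map_dvd (residue h p e) h1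
    rw [Polynomial.map_sub, Polynomial.map_pow, Polynomial.map_pow, map_residue_proj,
      map_residue_proj] at h2
    convert h2 using 1; ring
  constructor
  · exact (hτ H).2 fun G _ h2 h3 => multiplicity_le_of_dvd_pow_mul hK hF0 hL0 hdvd h2 h3
  -- The exponent is lowered to `τ` modulo `p`, and only then is the divisibility lifted at the
  -- price of an `e`-th power. The return time obtained need not be `L`; `hH` accepts any.
  · have h1 := dvd_pow_mul_of_multiplicity_le hK hm0 hdvd ((hτ τ).1 le_rfl)
    have h2 : proj h p 1 m ∣ proj h p 1 (f ^ τ * (f ^ L - 1)) := by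
      simpa [proj] using h1
    have h3 := proj_dvd_pow (e := e) h2
    have hfin : Finite ((GR h p e)[X] ⧸ Ideal.span {proj h p e m}) :=
      (card_quotient_le hp hh (hm.map _)).1
    rw [← Ideal.mem_span_singleton, ← Ideal.Quotient.eq_zero_iff_mem] at h3
    obtain ⟨ℓ, h0, h4⟩ := exists_pow_add_eq_of_nilpotent (k := τ) (ℓ := L) (e := e)
      (a := Ideal.Quotient.mk (Ideal.span {proj h p e m}) (proj h p e f)) hL0 (by
        have hpr : proj h p e (f ^ τ * (f ^ L - 1)) =
            proj h p e f ^ τ * (proj h p e f ^ L - 1) := by simp [proj]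
        rw [← h3, hpr, map_pow, map_mul, map_sub, map_pow, map_pow, map_one])
    exact hH _ _ h0 h4

end GaloisRing

/-! ### Verification rules for programs -/

section Rules

variable {h : ℤ[X]} {p e : ℕ} [NeZero e] {M : ℕ → ℕ → ℝ} {c : ℕ}

/-- Started in `s`, the program `P` halts within time `T` in a state that satisfies `Q`. -/
def RunsWithin (M : ℕ → ℕ → ℝ) (c : ℕ) (P : Prog) (s : State h p e) (T : ℝ)
    (Q : State h p e → Prop) : Prop :=
  ∃ s' t, Runs M c P s s' t ∧ t ≤ T ∧ Q s'

variable {P P' : Prog} {s : State h p e} {T T' T₁ T₂ : ℝ} {Q Q' : State h p e → Prop}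

theorem RunsWithin.mono (hr : RunsWithin M c P s T Q) (hT : T ≤ T') (hQ : ∀ s', Q s' → Q' s') :
    RunsWithin M c P s T' Q' := by
  obtain ⟨s', t, h1, h2, h3⟩ := hr
  exact ⟨s', t, h1, h2.trans hT, hQ _ h3⟩

theorem RunsWithin.instr {i : Instr} (hT : i.time M c s ≤ T) (hQ : Q (i.exec s)) :
    RunsWithin M c (.instr i) s T Q :=
  ⟨_, _, .instr i s, hT, hQ⟩

theorem RunsWithin.skip (hT : 0 ≤ T) (hQ : Q s) : RunsWithin M c .skip s T Q :=
  ⟨_, _, .skip s, hT, hQ⟩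

theorem RunsWithin.seq (h₁ : RunsWithin M c P s T₁ Q')
    (h₂ : ∀ s', Q' s' → RunsWithin M c P' s' T₂ Q) :
    RunsWithin M c (.seq P P') s (T₁ + T₂) Q := by
  obtain ⟨s₁, t₁, r₁, ht₁, q₁⟩ := h₁
  obtain ⟨s₂, t₂, r₂, ht₂, q₂⟩ := h₂ s₁ q₁
  exact ⟨s₂, _, .seq r₁ r₂, add_le_add ht₁ ht₂, q₂⟩

theorem RunsWithin.block_nil (hQ : Q s) : RunsWithin M c (.block []) s 0 Q :=
  RunsWithin.skip le_rfl hQ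

theorem RunsWithin.block_cons {cs : List Prog} (h₁ : RunsWithin M c P s T₁ Q')
    (h₂ : ∀ s', Q' s' → RunsWithin M c (.block cs) s' T₂ Q) :
    RunsWithin M c (.block (P :: cs)) s (T₁ + T₂) Q :=
  RunsWithin.seq h₁ h₂

theorem RunsWithin.block_instr {i : Instr} {cs : List Prog} (hT : i.time M c s ≤ T₁)
    (h₂ : RunsWithin M c (.block cs) (i.exec s) T₂ Q) :
    RunsWithin M c (.block (.instr i :: cs)) s (T₁ + T₂) Q :=
  RunsWithin.block_cons (Q' := fun s' => s' = i.exec s) (RunsWithin.instr hT rfl)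
    (by rintro _ rfl; exact h₂)

theorem RunsWithin.ite {b : Test} (hT : b.time M c s ≤ T₁)
    (h₁ : b.holds s → RunsWithin M c P s T₂ Q) (h₂ : ¬ b.holds s → RunsWithin M c P' s T₂ Q) :
    RunsWithin M c (.ite b P P') s (T₁ + T₂) Q := by
  by_cases hb : b.holds s
  · obtain ⟨s', t, r, ht, q⟩ := h₁ hb
    exact ⟨s', _, .ite_true hb r, add_le_add hT ht, q⟩
  · obtain ⟨s', t, r, ht, q⟩ := h₂ hb
    exact ⟨s', _, .ite_false hb r, add_le_add hT ht, q⟩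

/-- A loop with invariant `I`, variant `v`, and uniform bounds for the time of the test and of the
body. -/
theorem RunsWithin.while {b : Test} (I : State h p e → Prop) (v : State h p e → ℕ) {N : ℕ}
    (h₁ : ∀ s, I s → b.time M c s ≤ T₁)
    (h₂ : ∀ s, I s → b.holds s → RunsWithin M c P s T₂ fun s' => I s' ∧ v s' < v s)
    (h0 : 0 ≤ T₁ + T₂) (hs : I s) (hv : v s ≤ N) :
    RunsWithin M c (.while b P) s (N * (T₁ + T₂) + T₁) fun s' => I s' ∧ ¬ b.holds s' := by
  induction N generalizing s with
  | zero =>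
    by_cases hb : b.holds s
    · obtain ⟨s₁, t₁, -, -, -, hlt⟩ := h₂ s hs hb
      omega
    · exact ⟨s, _, .while_false hb, by simpa using h₁ s hs, hs, hb⟩
  | succ N ih =>
    by_cases hb : b.holds s
    · obtain ⟨s₁, t₁, r₁, ht₁, hI, hlt⟩ := h₂ s hs hb
      obtain ⟨s₂, t₂, r₂, ht₂, q⟩ := ih hI (by omega)
      refine ⟨s₂, _, .while_true hb r₁ r₂, ?_, q⟩
      have := h₁ s hs
      push_cast
      linarith
    · refine ⟨s, _, .while_false hb, ?_, hs, hb⟩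
      have := h₁ s hs
      have : 0 ≤ ((N + 1 : ℕ) : ℝ) * (T₁ + T₂) := mul_nonneg (Nat.cast_nonneg _) h0
      linarith

end Rules

/-! ### Bit lengths -/

theorem bits_le {a : ℤ} {k : ℕ} (ha : a.natAbs < 2 ^ k) : bits a ≤ k + 1 :=
  Nat.add_le_add_right (Nat.size_le.2 ha) 1

/-- This bounds the rounds of square-and-multiply: halving a positive exponent shortens it by a bit.
-/
theorem size_half_lt {k : ℕ} (hk : 0 < k) : Nat.size (k / 2) < Nat.size k := by
  have h0 : 0 < Nat.size k := Nat.size_pos.2 hk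
  have : Nat.size (k / 2) ≤ Nat.size k - 1 := by
    rw [Nat.size_le]
    have := Nat.lt_size_self k
    obtain ⟨j, hj⟩ := Nat.exists_eq_succ_of_ne_zero h0.ne'
    rw [hj, Nat.succ_eq_add_one, pow_succ] at this
    rw [hj, Nat.succ_eq_add_one, Nat.add_sub_cancel]
    omega
  omega

/-- This bounds the rounds of the binary search, in which the number of candidates is at least
halved. -/
theorem size_le_of_two_mul_le {j k : ℕ} (hk : 0 < k) (hjk : 2 * j ≤ k) :
    Nat.size j < Nat.size k :=
  (Nat.size_le_size (show j ≤ k / 2 by omega)).trans_lt (size_half_lt hk)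

theorem bits_one : bits 1 = 2 := by decide

theorem bits_zero : bits 0 = 1 := by decide

/-! ### Time bounds for the primitive operations -/

/-- The time `D` of one operation on polynomials with at most `n` coefficients, and the length `lam`
of the coefficients. -/
structure CostBound (M : ℕ → ℕ → ℝ) (c : ℕ) (h : ℤ[X]) (p e n lam : ℕ) (D : ℝ) : Prop where
  one_lt_n : 1 < n
  one_le_lam : 1 ≤ lam
  c_le : (c : ℝ) ≤ D
  mulE : ∀ k, 1 ≤ k → k ≤ n → M e k ≤ D
  divE : ∀ k, 1 ≤ k → k ≤ n → c * M e k ≤ D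
  mulF : ∀ k, 1 ≤ k → k ≤ n → M 1 k ≤ D
  divF : ∀ k, 1 ≤ k → k ≤ n → c * M 1 k ≤ D
  elemF : elemBits h p 1 ≤ lam
  elemE : elemBits h p e ≤ e * lam
  lt_two_pow : n * e < 2 ^ lam

namespace CostBound

variable {h : ℤ[X]} {p e n lam c : ℕ} {M : ℕ → ℕ → ℝ} {D : ℝ}

theorem nonneg (B : CostBound M c h p e n lam D) : 0 ≤ D := (Nat.cast_nonneg c).trans B.c_le

/-- Since $c\le D$, an operation charged `x` bit operations costs at most `y * D` for any bound `y`
of `x`. All times become multiples of `D` in this way. -/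
theorem mul_le (B : CostBound M c h p e n lam D) {x y : ℕ} (hxy : x ≤ y) :
    (c : ℝ) * x ≤ y * D := by
  rw [mul_comm (y : ℝ)]
  exact mul_le_mul B.c_le (by exact_mod_cast hxy) (Nat.cast_nonneg _) B.nonneg

theorem bits_le_of_le [NeZero e] (B : CostBound M c h p e n lam D) {a : ℤ}
    (ha : a.natAbs ≤ n * e) : bits a ≤ lam + 1 :=
  bits_le (ha.trans_lt B.lt_two_pow)

theorem le_mul_e [NeZero e] : n ≤ n * e := Nat.le_mul_of_pos_right n (NeZero.pos e)

end CostBound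

/-! ### Modular powers -/

section Powers

variable {h : ℤ[X]} {p e : ℕ} {M : ℕ → ℕ → ℝ} {c n lam : ℕ} {D : ℝ}

theorem divTime_le (B : CostBound M c h p e n lam D) {a b : (GR h p e)[X]}
    (hb : 1 ≤ b.natDegree) (hbn : b.natDegree ≤ n) (ha : a.natDegree + 1 ≤ n + b.natDegree) :
    divTime M c e a b ≤ D :=
  B.divE _ (hb.trans (le_max_right _ _)) (max_le (by omega) hbn)

theorem divTime_one_le (B : CostBound M c h p e n lam D) {a b : (GR h p 1)[X]}
    (hb : 1 ≤ b.natDegree) (hbn : b.natDegree ≤ n) (ha : a.natDegree + 1 ≤ n + b.natDegree) :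
    divTime M c 1 a b ≤ D :=
  B.divF _ (hb.trans (le_max_right _ _)) (max_le (by omega) hbn)

theorem mk_modByMonic {K : Type*} [CommRing K] (a m : K[X]) :
    Ideal.Quotient.mk (Ideal.span {m}) (a %ₘ m) = Ideal.Quotient.mk (Ideal.span {m}) a := by
  rw [Ideal.Quotient.eq, Ideal.mem_span_singleton]
  refine ⟨-(a /ₘ m), ?_⟩
  conv_lhs => rw [modByMonic_eq_sub_mul_div a m]
  ring

variable [NeZero e]

/-- The invariant is $\mathrm{dst}\cdot\mathrm{base}^x\equiv f^N$ modulo `m`, read through a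
homomorphism `π` that does not see remainders. `S` bounds the bit length of the exponent and of a
reduced polynomial; at most `S` rounds of cost $O(SD)$ give the factor $S^2$. -/
theorem powMod_runsWithin (B : CostBound M c h p e n lam D) {m : (GR h p e)[X]} (hm : m.Monic)
    (hmn : m.natDegree = n) {A : Type*} [CommRing A] {π : (GR h p e)[X] →+* A}
    (hmod : ∀ a, π (a %ₘ m) = π a) {S : ℕ} (hS : n * (e * lam) ≤ S)
    {dst : PVar} (hdm : dst ≠ .m) (hdb' : dst ≠ .base) {E : ZExpr}
    {s : State h p e} (hsm : s.poly .m = m) (hf : (s.poly .f).natDegree < n)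
    {N : ℕ} (hN : E.val s.int = N) (hNS : N < 2 ^ S) (hE : E.time s.int ≤ 8 * S) :
    RunsWithin M c (powMod dst E) s (35 * (S : ℝ) ^ 2 * D) fun s' =>
      (∀ v, v ≠ .x → s'.int v = s.int v) ∧
      (∀ v, v ≠ dst → v ≠ .base → s'.poly v = s.poly v) ∧
      π (s'.poly dst) = π (s.poly .f) ^ N ∧
      (s'.poly dst).natDegree < n := by
  have hn := B.one_lt_n
  have hlam := B.one_le_lam
  have he : 1 ≤ e := NeZero.one_le
  have hD := B.nonneg
  have hc := B.c_le
  have helem := B.elemE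
  have hS1 : 1 ≤ S := by
    have : 1 ≤ n * (e * lam) := Nat.mul_pos (by omega) (Nat.mul_pos he hlam)
    omega
  have hS1' : (1 : ℝ) ≤ S := by exact_mod_cast hS1
  have hm1 : m ≠ 1 := by rintro rfl; simp at hmn; omega
  have hdeg : ∀ a : (GR h p e)[X], (a %ₘ m).natDegree < n := fun a =>
    hmn ▸ natDegree_modByMonic_lt a hm hm1
  have hmul : ∀ a b : (GR h p e)[X], a.natDegree < n → b.natDegree < n →
      mulTime M e a b ≤ D := fun a b ha hb => B.mulE _ (by omega) (by
        have := max_lt ha hb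
        omega)
  have hrem : ∀ a b : (GR h p e)[X], a.natDegree < n → b.natDegree < n →
      divTime M c e (a * b) m ≤ D := fun a b ha hb =>
    divTime_le B (by omega) (by omega) (by
      have := natDegree_mul_le (p := a) (q := b)
      omega)
  set I : State h p e → Prop := fun s' =>
    (∀ v, v ≠ .x → s'.int v = s.int v) ∧
    (∀ v, v ≠ dst → v ≠ .base → s'.poly v = s.poly v) ∧
    ∃ k : ℕ, s'.int .x = k ∧ k < 2 ^ S ∧
      π (s'.poly dst) * π (s'.poly .base) ^ k = π (s.poly .f) ^ N ∧
      (s'.poly dst).natDegree < n ∧ (s'.poly .base).natDegree < n with hI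
  have hloop : ∀ s₁, I s₁ → RunsWithin M c
      (.while (.leZ (.const 1) (.var .x)) (.block [
        .ite (.oddZ .x)
          (.block [.instr (.mulP dst dst .base), .instr (.remP dst dst .m)])
          .skip,
        .instr (.mulP .base .base .base),
        .instr (.remP .base .base .m),
        .instr (.setZ .x (.half (.var .x)))])) s₁
      (S * (8 * S * D + 9 * S * D) + 8 * S * D)
      fun s' => I s' ∧ ¬ (Test.leZ (.const 1) (.var .x)).holds s' := by
    intro s₁ hs₁
    refine RunsWithin.while I (fun s' => Nat.size (s'.int .x).toNat) ?_ ?_ (by positivity) hs₁ ?_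
    · rintro s₂ ⟨-, -, k, hk, hkS, -⟩
      have hb : bits (k : ℤ) ≤ S + 1 := bits_le (by simpa using hkS)
      have := B.mul_le (x := bits 1 + bits k + (bits 1 + bits k)) (y := 8 * S)
        (by rw [bits_one]; omega)
      simp only [Test.time, ZExpr.time, ZExpr.val, hk]
      push_cast at this
      exact this
    · rintro s₂ ⟨hi, hp, k, hk, hkS, hprod, hdd, hdb⟩ hpos
      have hk0 : 1 ≤ k := by
        simp only [Test.holds, ZExpr.val, hk] at hpos
        exact_mod_cast hpos
      have hm₂ : s₂.poly .m = m := by rw [hp _ hdm.symm (by decide), hsm]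
      -- The intermediate assertion absorbs the low bit of `k` into `dst`, leaving
      -- $(\mathrm{base}^2)^{\lfloor k/2\rfloor}$ before `base` is squared.
      refine RunsWithin.mono (RunsWithin.block_cons (T₁ := D + 2 * D) (T₂ := D + (D + (4 * S * D + 0)))
        (Q' := fun s₃ => s₃.int = s₂.int ∧
          (∀ v, v ≠ dst → s₃.poly v = s₂.poly v) ∧
          π (s₃.poly dst) * (π (s₂.poly .base) ^ 2) ^ (k / 2) = π (s.poly .f) ^ N ∧
          (s₃.poly dst).natDegree < n) ?_ ?_) (Q := fun s' => I s' ∧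
            Nat.size (s'.int .x).toNat < Nat.size (s₂.int .x).toNat) ?_ (fun _ h => h)
      · refine RunsWithin.ite (by simpa [Test.time] using hc) ?_ ?_
        · intro hodd
          simp only [Test.holds, hk] at hodd
          have hodd' : k % 2 = 1 := by
            have : Odd k := by exact_mod_cast hodd
            exact Nat.odd_iff.1 this
          refine RunsWithin.mono (RunsWithin.block_instr (hmul _ _ hdd hdb)
            (RunsWithin.block_instr (T₁ := D) ?_ (RunsWithin.block_nil ?_))) (by linarith)
            (fun _ h => h)
          · simpa [Instr.time, Instr.exec, Function.update_of_ne hdm.symm, hm₂] using hrem _ _ hdd hdb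
          · simp only [Instr.exec, Function.update_self, Function.update_of_ne hdm.symm, hm₂]
            refine ⟨trivial, ?_, ?_, hdeg _⟩
            · intro v hv; simp [Function.update_of_ne hv]
            · rw [hmod, map_mul, ← hprod, ← pow_mul, mul_assoc, ← pow_succ']
              congr 2; omega
        · intro hodd
          simp only [Test.holds, hk] at hodd
          have hev : k % 2 = 0 := by
            have : ¬ Odd k := by exact_mod_cast hodd
            rwa [Nat.not_odd_iff_even, Nat.even_iff] at this
          refine RunsWithin.skip (by linarith) ⟨rfl, fun _ _ => rfl, ?_, hdd⟩
          rw [← hprod, ← pow_mul]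
          congr 2; omega
      · rintro s₃ ⟨hi₃, hp₃, hprod₃, hd₃⟩
        have hb₃ : s₃.poly .base = s₂.poly .base := hp₃ _ hdb'.symm
        have hm₃ : s₃.poly .m = m := by rw [hp₃ _ hdm.symm, hm₂]
        have hk₃ : s₃.int .x = k := by rw [hi₃, hk]
        refine RunsWithin.block_instr (hmul _ _ (hb₃ ▸ hdb) (hb₃ ▸ hdb))
            (RunsWithin.block_instr (T₁ := D) ?_ (RunsWithin.block_instr ?_
              (RunsWithin.block_nil ?_)))
        · simpa [Instr.time, Instr.exec, hm₃, hb₃] using hrem _ _ hdb hdb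
        · have hb : bits (k : ℤ) ≤ S + 1 := bits_le (by simpa using hkS)
          have := B.mul_le (x := bits k + bits k) (y := 4 * S) (by omega)
          simp only [Instr.time, Instr.exec, ZExpr.time, ZExpr.val, hk₃]
          push_cast at this ⊢
          exact this
        · have hx : ((k : ℤ) / 2) = ((k / 2 : ℕ) : ℤ) := by simp
          simp only [Instr.exec, ZExpr.val, hk₃, Function.update_self, hm₃, hk, hx,
            Function.update_of_ne (show PVar.m ≠ PVar.base by decide), hI,
            Function.update_of_ne hdb', hb₃, Int.toNat_natCast]
          refine ⟨⟨?_, ?_, k / 2, rfl, by omega, ?_, hd₃, hdeg _⟩, size_half_lt hk0⟩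
          · intro v hv
            rw [Function.update_of_ne hv, hi₃, hi v hv]
          · intro v hv hv'
            simp only [Function.update_of_ne hv', hp₃ v hv, hp v hv hv']
          · rw [hmod, map_mul, ← hprod₃, sq]
      · nlinarith
    · obtain ⟨-, -, k, hk, hkS, -⟩ := hs₁
      simp only [hk, Int.toNat_natCast]
      exact Nat.size_le.2 hkS
  refine RunsWithin.mono (RunsWithin.block_instr (T₁ := (8 * S) * D) ?_
    (RunsWithin.block_instr (T₁ := S * D) ?_ (RunsWithin.block_instr (T₁ := S * D) ?_
      (RunsWithin.block_cons (hloop _ ?_) (fun s' hs' => RunsWithin.block_nil hs'))))) ?_ ?_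
  · have := B.mul_le hE
    simpa [Instr.time] using this
  · simp only [Instr.time, Instr.exec, polyBits]
    exact B.mul_le ((Nat.mul_le_mul (show _ ≤ n by omega) helem).trans hS)
  · simp only [Instr.time, polyBits, natDegree_one, zero_add]
    exact B.mul_le ((Nat.mul_le_mul (show 1 ≤ n by omega) helem).trans hS)
  · simp only [Instr.exec, hI, Function.update_self, Function.update_of_ne hdb'.symm, hN,
      natDegree_one]
    refine ⟨fun v hv => Function.update_of_ne hv _ _, ?_, N, rfl, hNS, ?_, by omega, hf⟩
    · intro v hv hv'
      simp only [Function.update_of_ne hv, Function.update_of_ne hv']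
    · rw [map_one, one_mul]
  · have : (S : ℝ) * D ≤ S ^ 2 * D := by
      rw [sq, mul_assoc]
      exact le_mul_of_one_le_left (by positivity) hS1'
    nlinarith
  · rintro s' ⟨⟨h1, h2, k, hk, -, hprod, hdd, -⟩, hneg⟩
    have : k = 0 := by
      simp only [Test.holds, ZExpr.val, hk] at hneg
      omega
    subst this
    exact ⟨h1, h2, by simpa using hprod, hdd⟩

end Powers

/-! ### The decomposition over the residue field -/

section Decompose

theorem mul_divByMonic_of_dvd {K : Type*} [CommRing K] {a g : K[X]} (hg : g.Monic) (hd : g ∣ a) :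
    g * (a /ₘ g) = a := by
  have := modByMonic_add_div a g
  rwa [(modByMonic_eq_zero_iff_dvd hg).2 hd, zero_add] at this

/-- This absorbs every summand of a running time into one common monomial. -/
theorem pow_mul_pow_mul_pow_le {x y z D : ℝ} (hx : 1 ≤ x) (hy : 1 ≤ y) (hz : 1 ≤ z) (hD : 0 ≤ D)
    {a b c a' b' c' : ℕ} (ha : a ≤ a') (hb : b ≤ b') (hc : c ≤ c') :
    x ^ a * y ^ b * z ^ c * D ≤ x ^ a' * y ^ b' * z ^ c' * D := by
  gcongr

variable {h : ℤ[X]} {p e : ℕ} {M : ℕ → ℕ → ℝ} {c n lam : ℕ} {D : ℝ}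

/-- The properties of a list of factors that are relevant for the time bounds. -/
def FactorBounds (n : ℕ) (L : List ((GR h p 1)[X] × ℕ)) : Prop :=
  ∀ x ∈ L, x.1.Monic ∧ 1 ≤ x.1.natDegree ∧ x.1.natDegree < n ∧ 0 < x.2 ∧ x.2 ≤ n

variable [NeZero e]

/-- Each round moves one factor `G` from `M1` to `M2`, so the product is invariant and the degree of
`M1` drops. That the new `M1` divides the old one keeps the factors treated earlier from dividing
it. -/
theorem decompose_inner_runsWithin (B : CostBound M c h p e n lam D) {mbar : (GR h p 1)[X]}
    (hmn : mbar.natDegree ≤ n) {s : State h p e} (hG : (s.fpoly .G).Monic)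
    (hG1 : 1 ≤ (s.fpoly .G).natDegree) (hGn : (s.fpoly .G).natDegree < n)
    (h1 : (s.fpoly .M1).Monic) (h2 : (s.fpoly .M2).Monic)
    (hprod : s.fpoly .M1 * s.fpoly .M2 = mbar) :
    RunsWithin M c (.while (.dvdF .G .M1) (.block [
      .instr (.quoF .M1 .M1 .G),
      .instr (.mulF .M2 .M2 .G)])) s (4 * n * D) fun s' =>
      s'.int = s.int ∧ s'.poly = s.poly ∧ s'.factors = s.factors ∧ s'.rest = s.rest ∧
      (s'.fpoly .M1).Monic ∧ (s'.fpoly .M2).Monic ∧ s'.fpoly .M1 * s'.fpoly .M2 = mbar ∧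
      s'.fpoly .M1 ∣ s.fpoly .M1 ∧ ¬ s.fpoly .G ∣ s'.fpoly .M1 := by
  have hn := B.one_lt_n
  have hD := B.nonneg
  have hdeg : ∀ {a b : (GR h p 1)[X]}, a.Monic → b.Monic → a * b = mbar →
      a.natDegree + b.natDegree ≤ n := by
    intro a b ha hb hab
    rw [← ha.natDegree_mul hb, hab]; exact hmn
  set I : State h p e → Prop := fun s' =>
    s'.int = s.int ∧ s'.poly = s.poly ∧ s'.factors = s.factors ∧ s'.rest = s.rest ∧
      (s'.fpoly .M1).Monic ∧ (s'.fpoly .M2).Monic ∧ s'.fpoly .M1 * s'.fpoly .M2 = mbar ∧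
      s'.fpoly .M1 ∣ s.fpoly .M1 ∧ s'.fpoly .G = s.fpoly .G with hI
  have hdiv : ∀ {s₁ : State h p e}, I s₁ → divTime M c 1 (s₁.fpoly .M1) (s₁.fpoly .G) ≤ D := by
    rintro s₁ ⟨-, -, -, -, i1, i2, i3, -, i5⟩
    have := hdeg i1 i2 i3
    rw [i5]
    exact divTime_one_le B hG1 hGn.le (by omega)
  have hloop := RunsWithin.while (M := M) (c := c) (s := s) (b := .dvdF .G .M1)
    (P := .block [.instr (.quoF .M1 .M1 .G), .instr (.mulF .M2 .M2 .G)])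
    (T₁ := D) (T₂ := D + (D + 0)) (N := n) I
    (fun s' => (s'.fpoly .M1).natDegree) (fun s₁ hs₁ => hdiv hs₁) ?_ (by linarith)
    ⟨rfl, rfl, rfl, rfl, h1, h2, hprod, dvd_rfl, rfl⟩ ?_
  · refine hloop.mono ?_ ?_
    · have : (1 : ℝ) ≤ n := by exact_mod_cast hn.le
      nlinarith
    · rintro s' ⟨⟨a1, a2, a3, a4, a5, a6, a7, a8, a9⟩, hb⟩
      refine ⟨a1, a2, a3, a4, a5, a6, a7, a8, fun hd => hb ?_⟩
      simp only [Test.holds]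
      rw [a9]
      exact (modByMonic_eq_zero_iff_dvd hG).2 hd
  · intro s₁ hs₁ hb
    have hdiv₁ := hdiv hs₁
    obtain ⟨a1, a2, a3, a4, a5, a6, a7, a8, a9⟩ := hs₁
    simp only [Test.holds] at hb
    rw [a9, modByMonic_eq_zero_iff_dvd hG] at hb
    have hq := mul_divByMonic_of_dvd hG hb
    have hqm : (s₁.fpoly .M1 /ₘ s.fpoly .G).Monic := hG.of_mul_monic_left (hq.symm ▸ a5)
    have hqd : (s.fpoly .G).natDegree + (s₁.fpoly .M1 /ₘ s.fpoly .G).natDegree =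
        (s₁.fpoly .M1).natDegree := by rw [← hG.natDegree_mul hqm, hq]
    have hle := hdeg a5 a6 a7
    refine RunsWithin.block_instr hdiv₁ (RunsWithin.block_instr ?_ (RunsWithin.block_nil ?_))
    · simp only [Instr.time, Instr.exec, ne_eq, reduceCtorEq, not_false_eq_true,
        Function.update_of_ne, a9]
      refine B.mulF _ (by omega) ?_
      -- `M1` still contains `G`, of positive degree, so `M2` has degree less than `n`.
      have : max (s₁.fpoly .M2).natDegree (s.fpoly .G).natDegree < n := max_lt (by omega) hGn
      omega
    · simp only [Instr.exec, ne_eq, reduceCtorEq, not_false_eq_true, hI,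
        Function.update_of_ne, Function.update_self, a9]
      refine ⟨⟨a1, a2, a3, a4, hqm, a6.mul hG, ?_, ?_, trivial⟩, by omega⟩
      · rw [← a7]; conv_rhs => rw [← hq]
        ring
      · exact (Dvd.intro_left _ hq).trans a8
  · have := hdeg h1 h2 hprod
    omega

theorem next_time_le (B : CostBound M c h p e n lam D) {s : State h p e}
    (hL : FactorBounds n s.rest) (hne : s.rest ≠ []) :
    Instr.next.time M c s ≤ 3 * n * lam * D := by
  have hn := B.one_lt_n
  have hlam := B.one_le_lam
  match hr : s.rest with
  | [] => exact absurd hr hne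
  | (G, k) :: gs =>
    obtain ⟨-, -, g3, -, g5⟩ := hL (G, k) (by simp [hr])
    have hb : bits (k : ℤ) ≤ lam + 1 := B.bits_le_of_le (by
      have : n ≤ n * e := CostBound.le_mul_e
      simp only [Int.natAbs_natCast] at g5 ⊢; omega)
    have hp' : polyBits h p 1 G ≤ n * lam := Nat.mul_le_mul (by simpa using g3) B.elemF
    have h1 : lam ≤ n * lam := Nat.le_mul_of_pos_left _ (by omega)
    have := B.mul_le (x := polyBits h p 1 G + bits k) (y := 3 * n * lam) (by
      rw [mul_assoc]; omega)
    simp only [Instr.time, hr]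
    push_cast at this
    exact this

/-- The invariant splits the list into `done`, no entry of which divides `M1`, and the unread rest.
At most `n` factors with at most `n` divisions each are charged, which is the factor $n^2$. -/
theorem decompose_runsWithin (B : CostBound M c h p e n lam D) {s : State h p e}
    (hm : (s.poly .m).Monic) (hmn : (s.poly .m).natDegree = n) (hL : FactorBounds n s.factors)
    (hlen : s.factors.length ≤ n) :
    RunsWithin M c decompose s (16 * (n : ℝ) ^ 2 * e ^ 2 * lam ^ 2 * D) fun s' =>
      (∀ v, v ≠ .k → s'.int v = s.int v) ∧ s'.poly = s.poly ∧ s'.factors = s.factors ∧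
      (s'.fpoly .M1).Monic ∧ (s'.fpoly .M2).Monic ∧
      s'.fpoly .M1 * s'.fpoly .M2 = (s.poly .m).map (residue h p e) ∧
      ∀ x ∈ s.factors, ¬ x.1 ∣ s'.fpoly .M1 := by
  have hn := B.one_lt_n
  have hlam := B.one_le_lam
  have he : 1 ≤ e := NeZero.one_le
  have hD := B.nonneg
  have hc := B.c_le
  have hn' : (1 : ℝ) ≤ n := by exact_mod_cast hn.le
  have hlam' : (1 : ℝ) ≤ lam := by exact_mod_cast hlam
  have he' : (1 : ℝ) ≤ e := by exact_mod_cast he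
  set mbar := (s.poly .m).map (residue h p e) with hmbar
  have hbn : mbar.natDegree ≤ n := hmn ▸ natDegree_map_le
  set I : State h p e → Prop := fun s' =>
    (∀ v, v ≠ .k → s'.int v = s.int v) ∧ s'.poly = s.poly ∧ s'.factors = s.factors ∧
      (s'.fpoly .M1).Monic ∧ (s'.fpoly .M2).Monic ∧
      s'.fpoly .M1 * s'.fpoly .M2 = mbar ∧
      ∃ done, s.factors = done ++ s'.rest ∧ ∀ x ∈ done, ¬ x.1 ∣ s'.fpoly .M1 with hI
  have hloop : ∀ s₁, I s₁ → s₁.rest.length ≤ n → RunsWithin M c (.while .more (.block [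
      .instr .next,
      .while (.dvdF .G .M1) (.block [
        .instr (.quoF .M1 .M1 .G),
        .instr (.mulF .M2 .M2 .G)])])) s₁
      (n * (D + (3 * n * lam * D + (4 * n * D + 0))) + D) fun s' =>
        I s' ∧ ¬ Test.more.holds s' := by
    intro s₁ hs₁ hlen₁
    refine RunsWithin.while I (fun s' => s'.rest.length) (fun s₂ _ => hc) ?_ (by positivity)
      hs₁ hlen₁
    rintro s₂ ⟨a1, a2, a3, a4, a5, a6, done, a7, a8⟩ hb
    simp only [Test.holds] at hb
    have hL₂ : FactorBounds n s₂.rest := fun x hx => hL x (by rw [a7]; simp [hx])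
    refine RunsWithin.block_instr (next_time_le B hL₂ hb) ?_
    match hr : s₂.rest with
    | [] => exact absurd hr hb
    | (G, k) :: gs =>
      obtain ⟨g1, g2, g3, -⟩ := hL₂ (G, k) (by simp [hr])
      simp only [Instr.exec, hr]
      refine RunsWithin.block_cons (decompose_inner_runsWithin B hbn ?_ ?_ ?_ ?_ ?_ ?_)
        (fun s₃ hs₃ => RunsWithin.block_nil ?_)
      · simpa using g1
      · simpa using g2
      · simpa using g3
      · simpa using a4
      · simpa using a5
      · simpa using a6
      · simp only [ne_eq, reduceCtorEq, not_false_eq_true, Function.update_of_ne,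
          Function.update_self] at hs₃
        obtain ⟨b1, b2, b3, b4, b5, b6, b7, b8, b9⟩ := hs₃
        refine ⟨⟨?_, b2.trans a2, b3.trans a3, b5, b6, b7, done ++ [(G, k)], ?_, ?_⟩, ?_⟩
        · intro v hv
          rw [b1, Function.update_of_ne hv, a1 v hv]
        · rw [a7, hr, b4]; simp
        · intro x hx
          rcases List.mem_append.1 hx with hx | hx
          · exact fun hd => a8 x hx (hd.trans b8)
          · rw [List.mem_singleton.1 hx]; exact b9
        · rw [b4]; simp
  refine RunsWithin.mono (RunsWithin.block_instr (T₁ := 2 * n * (e * lam) ^ 2 * D) ?_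
    (RunsWithin.block_instr (T₁ := lam * D) ?_ (RunsWithin.block_instr (T₁ := D) hc
      (RunsWithin.block_cons (hloop _ ?_ hlen) fun s' hs' => RunsWithin.block_nil hs')))) ?_ ?_
  · have := B.mul_le (x := (n + 1) * elemBits h p e ^ 2) (y := 2 * n * (e * lam) ^ 2)
      (Nat.mul_le_mul (by omega) (Nat.pow_le_pow_left B.elemE 2))
    simp only [Instr.time, hmn]
    push_cast at this ⊢
    exact this
  · simp only [Instr.time, polyBits, natDegree_one, zero_add, one_mul]
    exact B.mul_le B.elemF
  · simp only [hI, Instr.exec, ne_eq, reduceCtorEq, not_false_eq_true, Function.update_of_ne,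
      Function.update_self]
    exact ⟨fun _ _ => trivial, trivial, trivial, hm.map _, monic_one, mul_one _, [], rfl, by simp⟩
  · have key := fun {a b c : ℕ} => pow_mul_pow_mul_pow_le (a := a) (b := b) (c := c) (a' := 2)
      (b' := 2) (c' := 2) hn' he' hlam' hD
    have e1 := key (show 0 ≤ 2 by simp) (show 0 ≤ 2 by simp) (show 0 ≤ 2 by simp)
    have e2 := key (show 1 ≤ 2 by simp) (show 0 ≤ 2 by simp) (show 0 ≤ 2 by simp)
    have e3 := key (show 2 ≤ 2 by simp) (show 0 ≤ 2 by simp) (show 1 ≤ 2 by simp)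
    have e4 := key (show 2 ≤ 2 by simp) (show 0 ≤ 2 by simp) (show 0 ≤ 2 by simp)
    have e5 := key (show 1 ≤ 2 by simp) (show 2 ≤ 2 by simp) (show 2 ≤ 2 by simp)
    have e6 := key (show 0 ≤ 2 by simp) (show 0 ≤ 2 by simp) (show 1 ≤ 2 by simp)
    simp only [pow_zero, pow_one, one_mul, mul_one] at e1 e2 e3 e4 e5 e6
    nlinarith
  · rintro s' ⟨⟨a1, a2, a3, a4, a5, a6, done, a7, a8⟩, hb⟩
    simp only [Test.holds, not_not] at hb
    rw [hb, List.append_nil] at a7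
    exact ⟨a1, a2, a3, a4, a5, a6, a7 ▸ a8⟩

end Decompose

/-! ### The height over the residue field -/

section FieldHeight

variable {h : ℤ[X]} {p e : ℕ} {M : ℕ → ℕ → ℝ} {c n lam : ℕ} {D : ℝ}

theorem neg_ediv_neg_le_iff {a k : ℤ} (hk : 0 < k) (j : ℤ) : -(-a / k) ≤ j ↔ a ≤ j * k := by
  rw [neg_le, Int.le_ediv_iff_mul_le hk]
  constructor <;> intro h <;> linarith

/-- A power of a monic polynomial is cancellable over any commutative ring, so the count of
successful divisions is the exponent. -/
theorem multiplicity_eq_of_mul_pow {K : Type*} [CommRing K] {a b g : K[X]} {k : ℕ} (hg : g.Monic)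
    (hab : a * g ^ k = b) (ha : ¬ g ∣ a) : multiplicity g b = k := by
  refine multiplicity_eq_of_dvd_of_not_dvd (Dvd.intro_left _ hab) fun ⟨r, hr⟩ => ha ⟨r, ?_⟩
  have : a * g ^ k = g * r * g ^ k := by rw [hab, hr]; ring
  exact (hg.pow k).isRegular.right this

variable [NeZero e]

/-- The invariant is $A\cdot G^{\kappa}=M_2$; on exit `G` does not divide `A`. -/
theorem fieldHeight_inner_runsWithin (B : CostBound M c h p e n lam D) {M2 : (GR h p 1)[X]}
    (hmn : M2.natDegree ≤ n) {s : State h p e} (hG : (s.fpoly .G).Monic)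
    (hG1 : 1 ≤ (s.fpoly .G).natDegree) (hGn : (s.fpoly .G).natDegree < n)
    (hA : s.fpoly .A = M2) (hM2 : M2.Monic) (hκ : s.int .kappa = 0) :
    RunsWithin M c (.while (.dvdF .G .A) (.block [
      .instr (.quoF .A .A .G),
      .instr (.setZ .kappa (.add (.var .kappa) (.const 1)))])) s (11 * n * lam * D) fun s' =>
      (∀ v, v ≠ .kappa → s'.int v = s.int v) ∧ s'.poly = s.poly ∧ s'.factors = s.factors ∧
      s'.rest = s.rest ∧ (∀ v, v ≠ .A → s'.fpoly v = s.fpoly v) ∧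
      s'.int .kappa = multiplicity (s.fpoly .G) M2 ∧ multiplicity (s.fpoly .G) M2 ≤ n := by
  have hn := B.one_lt_n
  have hlam := B.one_le_lam
  have hD := B.nonneg
  have hn' : (1 : ℝ) ≤ n := by exact_mod_cast hn.le
  have hlam' : (1 : ℝ) ≤ lam := by exact_mod_cast hlam
  set I : State h p e → Prop := fun s' =>
    (∀ v, v ≠ .kappa → s'.int v = s.int v) ∧ s'.poly = s.poly ∧ s'.factors = s.factors ∧
      s'.rest = s.rest ∧ (∀ v, v ≠ .A → s'.fpoly v = s.fpoly v) ∧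
      (s'.fpoly .A).Monic ∧ ∃ k : ℕ, s'.int .kappa = k ∧
        s'.fpoly .A * s.fpoly .G ^ k = M2 with hI
  have hdeg : ∀ {a : (GR h p 1)[X]} {k : ℕ}, a.Monic → a * s.fpoly .G ^ k = M2 →
      a.natDegree + k ≤ n := by
    intro a k ha hab
    have := ha.natDegree_mul (hG.pow k)
    rw [hab, hG.natDegree_pow] at this
    have : k ≤ k * (s.fpoly .G).natDegree := Nat.le_mul_of_pos_right _ hG1
    omega
  have hdiv : ∀ {s₁ : State h p e}, I s₁ → divTime M c 1 (s₁.fpoly .A) (s₁.fpoly .G) ≤ D := by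
    rintro s₁ ⟨-, -, -, -, i1, i2, k, -, i4⟩
    have := hdeg i2 i4
    rw [i1 .G (by decide)]
    exact divTime_one_le B hG1 hGn.le (by omega)
  have hloop := RunsWithin.while (M := M) (c := c) (s := s) (b := .dvdF .G .A)
    (P := .block [.instr (.quoF .A .A .G), .instr (.setZ .kappa (.add (.var .kappa) (.const 1)))])
    (T₁ := D) (T₂ := D + (8 * lam * D + 0)) (N := n) I
    (fun s' => (s'.fpoly .A).natDegree) (fun s₁ hs₁ => hdiv hs₁) ?_ (by positivity)
    ⟨fun _ _ => rfl, rfl, rfl, rfl, fun _ _ => rfl, hA.symm ▸ hM2, 0, hκ, by simp [hA]⟩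
    (by rw [hA]; exact hmn)
  · refine hloop.mono ?_ ?_
    · have e1 : D ≤ n * lam * D :=
        le_mul_of_one_le_left hD (one_le_mul_of_one_le_of_one_le hn' hlam')
      have e2 : n * D ≤ n * lam * D := by
        gcongr
        exact le_mul_of_one_le_right (by positivity) hlam'
      nlinarith
    · rintro s' ⟨⟨a1, a2, a3, a4, a5, a6, k, a7, a8⟩, hb⟩
      have hmul := multiplicity_eq_of_mul_pow hG a8 fun hd => hb (by
        simp only [Test.holds]
        rw [a5 .G (by decide)]
        exact (modByMonic_eq_zero_iff_dvd hG).2 hd)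
      have := hdeg a6 a8
      exact ⟨a1, a2, a3, a4, a5, by rw [a7, hmul], by omega⟩
  · intro s₁ hs₁ hb
    have hdiv₁ := hdiv hs₁
    obtain ⟨a1, a2, a3, a4, a5, a6, k, a7, a8⟩ := hs₁
    have a9 := a5 .G (by decide)
    simp only [Test.holds] at hb
    rw [a9, modByMonic_eq_zero_iff_dvd hG] at hb
    have hq := mul_divByMonic_of_dvd hG hb
    have hqm : (s₁.fpoly .A /ₘ s.fpoly .G).Monic := hG.of_mul_monic_left (hq.symm ▸ a6)
    have hqd : (s.fpoly .G).natDegree + (s₁.fpoly .A /ₘ s.fpoly .G).natDegree =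
        (s₁.fpoly .A).natDegree := by rw [← hG.natDegree_mul hqm, hq]
    have hle := hdeg a6 a8
    refine RunsWithin.block_instr hdiv₁ (RunsWithin.block_instr ?_ (RunsWithin.block_nil ?_))
    · have hbk : bits (k : ℤ) ≤ lam + 1 := B.bits_le_of_le (by
        have : n ≤ n * e := CostBound.le_mul_e
        simp only [Int.natAbs_natCast]; omega)
      have := B.mul_le (x := bits k + bits 1 + (bits k + bits 1)) (y := 8 * lam)
        (by rw [bits_one]; omega)
      simp only [Instr.time, Instr.exec, ZExpr.time, ZExpr.val, a7]
      push_cast at this ⊢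
      exact this
    · simp only [Instr.exec, ne_eq, hI, ZExpr.val, Function.update_self, a7, a9]
      refine ⟨⟨?_, a2, a3, a4, ?_, hqm, k + 1, by push_cast; rfl, ?_⟩, by omega⟩
      · intro v hv
        rw [Function.update_of_ne hv, a1 v hv]
      · intro v hv
        rw [Function.update_of_ne hv, a5 v hv]
      · rw [← a8]; conv_rhs => rw [← hq]
        ring

theorem ratio_runsWithin (B : CostBound M c h p e n lam D) {s : State h p e} {κ k τ : ℕ}
    (hκ : s.int .kappa = κ) (hk : s.int .k = k) (hτ : s.int .tau = τ) (hκn : κ ≤ n) (hk0 : 0 < k)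
    (hkn : k ≤ n) (hτn : τ ≤ n) :
    RunsWithin M c (.block [
      .instr (.setZ .ratio (.ceilDiv (.var .kappa) (.var .k))),
      .ite (.leZ (.var .ratio) (.var .tau)) .skip (.instr (.setZ .tau (.var .ratio)))]) s
      (8 * lam ^ 2 * D + (8 * lam * D + 2 * lam * D + 0)) fun s' =>
      (∀ v, v ≠ .ratio → v ≠ .tau → s'.int v = s.int v) ∧ s'.poly = s.poly ∧
      s'.fpoly = s.fpoly ∧ s'.factors = s.factors ∧ s'.rest = s.rest ∧
      ∃ τ' : ℕ, s'.int .tau = τ' ∧ τ' ≤ n ∧ ∀ j : ℕ, τ' ≤ j ↔ τ ≤ j ∧ κ ≤ j * k := by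
  have hlam := B.one_le_lam
  have hD := B.nonneg
  have hne : n ≤ n * e := CostBound.le_mul_e
  have hbits : ∀ {k : ℕ}, k ≤ n → bits (k : ℤ) ≤ lam + 1 := fun hk => B.bits_le_of_le (by
    simp only [Int.natAbs_natCast]; omega)
  have hk0' : (0 : ℤ) < k := by exact_mod_cast hk0
  have hratio : ∀ j : ℤ, -(-(κ : ℤ) / k) ≤ j ↔ (κ : ℤ) ≤ j * k := neg_ediv_neg_le_iff hk0'
  -- The ceiling is nonnegative: if it were at most $-1$, then $\kappa\le-k<0$.
  obtain ⟨ρ, hρ⟩ : ∃ ρ : ℕ, -(-(κ : ℤ) / k) = ρ := by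
    refine ⟨(-(-(κ : ℤ) / k)).toNat, (Int.toNat_of_nonneg ?_).symm⟩
    by_contra hneg
    have := (hratio (-1)).1 (by omega)
    omega
  have hρ' : ∀ j : ℕ, ρ ≤ j ↔ κ ≤ j * k := by
    intro j
    have := hratio j
    rw [hρ] at this
    exact_mod_cast this
  have hρn : ρ ≤ n := (hρ' n).2 (hκn.trans (Nat.le_mul_of_pos_right _ hk0))
  refine RunsWithin.block_instr ?_ (RunsWithin.block_cons (RunsWithin.ite ?_ ?_ ?_)
    fun s' hs' => RunsWithin.block_nil hs')
  · simp only [Instr.time, ZExpr.time, ZExpr.val, hκ, hk]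
    have h1 := hbits hκn
    have h2 := hbits hkn
    have h3 := Nat.mul_le_mul h1 h2
    have := B.mul_le (x := bits κ + bits k + bits κ * bits k) (y := 8 * lam ^ 2)
      (by nlinarith)
    push_cast at this ⊢
    exact this
  · simp only [Test.time, Instr.exec, ZExpr.time, ZExpr.val, hκ, hk, Function.update_self,
      ne_eq, reduceCtorEq, not_false_eq_true, Function.update_of_ne, hρ, hτ]
    have h1 := hbits hρn
    have h2 := hbits hτn
    have := B.mul_le (x := bits ρ + bits τ + (bits ρ + bits τ)) (y := 8 * lam) (by omega)
    push_cast at this ⊢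
    exact this
  · intro hle
    simp only [Test.holds, Instr.exec, ZExpr.val, hκ, hk, Function.update_self,
      ne_eq, reduceCtorEq, not_false_eq_true, Function.update_of_ne, hρ, hτ,
      Nat.cast_le] at hle
    refine RunsWithin.skip (by positivity) ?_
    simp only [Instr.exec, ne_eq, reduceCtorEq, not_false_eq_true, Function.update_of_ne]
    refine ⟨fun v hv _ => Function.update_of_ne hv _ _, trivial, trivial, trivial, trivial,
      τ, hτ, hτn, fun j => ?_⟩
    rw [← hρ']
    exact ⟨fun H => ⟨H, hle.trans H⟩, fun H => H.1⟩
  · intro hle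
    simp only [Test.holds, Instr.exec, ZExpr.val, hκ, hk, Function.update_self,
      ne_eq, reduceCtorEq, not_false_eq_true, Function.update_of_ne, hρ, hτ,
      Nat.cast_le, not_le] at hle
    refine RunsWithin.instr ?_ ?_
    · simp only [Instr.time, Instr.exec, ZExpr.time, ZExpr.val, hκ, hk,
        Function.update_self, hρ]
      have := B.mul_le (x := bits ρ) (y := 2 * lam) (by have := hbits hρn; omega)
      push_cast at this ⊢
      exact this
    · simp only [Instr.exec, ZExpr.val, ne_eq, Function.update_self, hκ, hk, hρ]
      refine ⟨fun v hv hv' => ?_, trivial, trivial, trivial, trivial, ρ, rfl, hρn, fun j => ?_⟩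
      · rw [Function.update_of_ne hv', Function.update_of_ne hv]
      · rw [← hρ']
        exact ⟨fun H => ⟨hle.le.trans H, H⟩, fun H => H.2⟩

/-- The maximum of the ceilings is described by its universal property: `τ ≤ k` if and only if every
ratio is at most `k`. This is the form that `height_mem_Icc` takes, and it also covers the empty
initial segment, with `τ = 0`. -/
theorem fieldHeight_runsWithin (B : CostBound M c h p e n lam D) {s : State h p e}
    {M2 : (GR h p 1)[X]} (hs2 : s.fpoly .M2 = M2) (hM2 : M2.Monic) (hmn : M2.natDegree ≤ n)
    (hL : FactorBounds n s.factors) (hlen : s.factors.length ≤ n) :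
    RunsWithin M c fieldHeight s (45 * (n : ℝ) ^ 2 * e ^ 2 * lam ^ 2 * D) fun s' =>
      s'.int .e = s.int .e ∧ s'.int .ellMax = s.int .ellMax ∧ s'.poly = s.poly ∧
      ∃ τ : ℕ, s'.int .tau = τ ∧ τ ≤ n ∧
        ∀ k : ℕ, τ ≤ k ↔ ∀ x ∈ s.factors, multiplicity x.1 M2 ≤ k * x.2 := by
  have hn := B.one_lt_n
  have hlam := B.one_le_lam
  have hD := B.nonneg
  have hc := B.c_le
  have hn' : (1 : ℝ) ≤ n := by exact_mod_cast hn.le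
  have hlam' : (1 : ℝ) ≤ lam := by exact_mod_cast hlam
  have he' : (1 : ℝ) ≤ e := by exact_mod_cast NeZero.one_le (n := e)
  set I : State h p e → Prop := fun s' =>
    s'.int .e = s.int .e ∧ s'.int .ellMax = s.int .ellMax ∧ s'.poly = s.poly ∧
      s'.factors = s.factors ∧ s'.fpoly .M2 = M2 ∧
      ∃ done, s.factors = done ++ s'.rest ∧ ∃ τ : ℕ, s'.int .tau = τ ∧ τ ≤ n ∧
        ∀ k : ℕ, τ ≤ k ↔ ∀ x ∈ done, multiplicity x.1 M2 ≤ k * x.2 with hI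
  have hloop : ∀ s₁, I s₁ → s₁.rest.length ≤ n → RunsWithin M c (.while .more (.block [
      .instr .next,
      .instr (.copyF .A .M2),
      .instr (.setZ .kappa (.const 0)),
      .while (.dvdF .G .A) (.block [
        .instr (.quoF .A .A .G),
        .instr (.setZ .kappa (.add (.var .kappa) (.const 1)))]),
      .instr (.setZ .ratio (.ceilDiv (.var .kappa) (.var .k))),
      .ite (.leZ (.var .ratio) (.var .tau)) .skip (.instr (.setZ .tau (.var .ratio)))])) s₁
      (n * (D + (3 * n * lam * D + (2 * n * lam * D + (D + (11 * n * lam * D +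
        (8 * lam ^ 2 * D + ((8 * lam * D + 2 * lam * D) + 0))))))) + D) fun s' =>
        I s' ∧ ¬ Test.more.holds s' := by
    intro s₁ hs₁ hlen₁
    refine RunsWithin.while I (fun s' => s'.rest.length) (fun s₂ _ => hc) ?_ (by positivity)
      hs₁ hlen₁
    rintro s₂ ⟨a1, a2, a3, a4, a5, done, a6, τ, a7, a8, a9⟩ hb
    simp only [Test.holds] at hb
    have hL₂ : FactorBounds n s₂.rest := fun x hx => hL x (by rw [a6]; simp [hx])
    refine RunsWithin.block_instr (next_time_le B hL₂ hb) ?_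
    match hr : s₂.rest with
    | [] => exact absurd hr hb
    | (G, k) :: gs =>
      obtain ⟨g1, g2, g3, g4, g5⟩ := hL₂ (G, k) (by simp [hr])
      simp only at g1 g2 g3 g4 g5
      simp only [Instr.exec, hr]
      refine RunsWithin.block_instr ?_ (RunsWithin.block_instr ?_ (RunsWithin.block_cons
        (fieldHeight_inner_runsWithin B hmn ?_ ?_ ?_ ?_ hM2 ?_) ?_))
      · simp only [Instr.time, polyBits, ne_eq, reduceCtorEq, not_false_eq_true,
          Function.update_of_ne, a5]
        have := B.mul_le (x := (M2.natDegree + 1) * elemBits h p 1) (y := 2 * n * lam)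
          (Nat.mul_le_mul (by omega) B.elemF)
        push_cast at this ⊢
        exact this
      · simpa [Instr.time, ZExpr.time, bits_zero] using hc
      · simpa [Instr.exec] using g1
      · simpa [Instr.exec] using g2
      · simpa [Instr.exec] using g3
      · simpa [Instr.exec] using a5
      · simp [Instr.exec, ZExpr.val]
      · intro s₃ hs₃
        simp only [Instr.exec, ZExpr.val] at hs₃
        obtain ⟨b1, b2, b3, b4, b5, b6, b7⟩ := hs₃
        simp only [ne_eq, reduceCtorEq, not_false_eq_true, Function.update_of_ne,
          Function.update_self] at b6 b7
        have bk : s₃.int .k = k := by rw [b1 _ (by decide)]; simp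
        have bt : s₃.int .tau = τ := by rw [b1 _ (by decide)]; simp [a7]
        have be : s₃.int .e = s.int .e := by rw [b1 _ (by decide)]; simp [a1]
        have bl : s₃.int .ellMax = s.int .ellMax := by rw [b1 _ (by decide)]; simp [a2]
        have bM : s₃.fpoly .M2 = M2 := by rw [b5 _ (by decide)]; simp [a5]
        refine (ratio_runsWithin B b6 bk bt b7 g4 g5 a8).mono le_rfl ?_
        rintro s₄ ⟨d1, d2, d3, d4, d5, τ', d6, d7, d8⟩
        refine ⟨⟨by rw [d1 _ (by decide) (by decide), be], by rw [d1 _ (by decide) (by decide), bl],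
          d2.trans (b2.trans a3), d4.trans (b3.trans a4), by rw [d3, bM], done ++ [(G, k)], ?_,
          τ', d6, d7, fun j => ?_⟩, ?_⟩
        · rw [a6, hr, d5, b4]; simp
        · rw [d8, a9]
          simp only [List.mem_append, List.mem_singleton]
          constructor
          · rintro ⟨H1, H2⟩ x (hx | rfl)
            · exact H1 x hx
            · exact H2
          · exact fun H => ⟨fun x hx => H x (.inl hx), H (G, k) (.inr rfl)⟩
        · rw [d5, b4]; simp
  refine RunsWithin.mono (RunsWithin.block_instr (T₁ := D) ?_
    (RunsWithin.block_instr (T₁ := D) hc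
      (RunsWithin.block_cons (hloop _ ?_ hlen) fun s' hs' => RunsWithin.block_nil hs'))) ?_ ?_
  · simpa [Instr.time, ZExpr.time, bits_zero] using hc
  · simp only [hI, Instr.exec, ZExpr.val, ne_eq, reduceCtorEq, not_false_eq_true,
      Function.update_of_ne, Function.update_self]
    exact ⟨trivial, trivial, trivial, trivial, hs2, [], rfl, 0, rfl, Nat.zero_le _, by simp⟩
  · have key := fun {a b c : ℕ} => pow_mul_pow_mul_pow_le (a := a) (b := b) (c := c) (a' := 2)
      (b' := 2) (c' := 2) hn' he' hlam' hD
    have e1 := key (show 0 ≤ 2 by simp) (show 0 ≤ 2 by simp) (show 0 ≤ 2 by simp)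
    have e2 := key (show 1 ≤ 2 by simp) (show 0 ≤ 2 by simp) (show 0 ≤ 2 by simp)
    have e3 := key (show 2 ≤ 2 by simp) (show 0 ≤ 2 by simp) (show 1 ≤ 2 by simp)
    have e4 := key (show 1 ≤ 2 by simp) (show 0 ≤ 2 by simp) (show 2 ≤ 2 by simp)
    have e5 := key (show 1 ≤ 2 by simp) (show 0 ≤ 2 by simp) (show 1 ≤ 2 by simp)
    simp only [pow_zero, pow_one, one_mul, mul_one] at e1 e2 e3 e4 e5
    nlinarith
  · rintro s' ⟨⟨a1, a2, a3, a4, a5, done, a6, a7⟩, hb⟩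
    simp only [Test.holds, not_not] at hb
    rw [hb, List.append_nil] at a6
    exact ⟨a1, a2, a3, a6 ▸ a7⟩

end FieldHeight

/-! ### Binary search -/

section Search

/-- Reduced representatives are unique, so comparing two registers decides a congruence modulo `m`.
-/
theorem eq_of_mk_eq_of_natDegree_lt {K : Type*} [CommRing K] [Nontrivial K] {m a b : K[X]}
    (hm : m.Monic) (ha : a.natDegree < m.natDegree) (hb : b.natDegree < m.natDegree)
    (hab : Ideal.Quotient.mk (Ideal.span {m}) a = Ideal.Quotient.mk (Ideal.span {m}) b) :
    a = b := by
  rw [Ideal.Quotient.eq, Ideal.mem_span_singleton] at hab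
  have h0 := (modByMonic_eq_zero_iff_dvd hm).2 hab
  have hlt : (a - b).degree < m.degree := by
    refine degree_lt_degree ((natDegree_sub_le a b).trans_lt (max_lt ha hb))
  rw [(modByMonic_eq_self_iff hm).2 hlt] at h0
  exact sub_eq_zero.1 h0

variable {h : ℤ[X]} {p e : ℕ} {M : ℕ → ℕ → ℝ} {c n lam : ℕ} {D : ℝ} {S : ℕ}

theorem eqP_time_le (B : CostBound M c h p e n lam D) (hS : n * (e * lam) ≤ S) {s : State h p e}
    (hl : (s.poly .lhs).natDegree < n) (hr : (s.poly .rhs).natDegree < n) :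
    (Test.eqP .lhs .rhs).time M c s ≤ 2 * S * D := by
  have h1 : polyBits h p e (s.poly .lhs) ≤ S := (Nat.mul_le_mul hl B.elemE).trans hS
  have h2 : polyBits h p e (s.poly .rhs) ≤ S := (Nat.mul_le_mul hr B.elemE).trans hS
  have := B.mul_le (x := polyBits h p e (s.poly .lhs) + polyBits h p e (s.poly .rhs)) (y := 2 * S)
    (by omega)
  simp only [Test.time]
  push_cast at this
  exact this

variable [NeZero e] {m : (GR h p e)[X]} {A : Type*} [CommRing A] {π : (GR h p e)[X] →+* A}

theorem bothSides_runsWithin (B : CostBound M c h p e n lam D) (hm : m.Monic)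
    (hmn : m.natDegree = n) (hmod : ∀ a, π (a %ₘ m) = π a)
    (hinj : ∀ a b, a.natDegree < n → b.natDegree < n → π a = π b → a = b)
    (hS : n * (e * lam) ≤ S) {s : State h p e} (hsm : s.poly .m = m)
    (hf : (s.poly .f).natDegree < n) {k L : ℕ} (hk : s.int .h = k) (hL : s.int .ellMax = L)
    (hkL : k + L < 2 ^ S) :
    RunsWithin M c bothSides s (70 * (S : ℝ) ^ 2 * D) fun s' =>
      (∀ v, v ≠ .x → s'.int v = s.int v) ∧ s'.poly .f = s.poly .f ∧ s'.poly .m = m ∧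
      (s'.poly .lhs).natDegree < n ∧ (s'.poly .rhs).natDegree < n ∧
      (s'.poly .lhs = s'.poly .rhs ↔ π (s.poly .f) ^ (k + L) = π (s.poly .f) ^ k) := by
  have hS1 : 1 ≤ S := le_trans (Nat.mul_pos (by have := B.one_lt_n; omega)
    (Nat.mul_pos (NeZero.pos e) B.one_le_lam)) hS
  have hbk : bits (k : ℤ) ≤ S + 1 := bits_le (by simp only [Int.natAbs_natCast]; omega)
  have hbL : bits (L : ℤ) ≤ S + 1 := bits_le (by simp only [Int.natAbs_natCast]; omega)
  refine RunsWithin.mono (RunsWithin.block_cons (powMod_runsWithin B hm hmn hmod hS (N := k + L)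
    (by decide) (by decide) hsm hf ?_ hkL ?_) fun s₁ hs₁ => RunsWithin.block_cons
      (Q' := fun s' => (∀ v, v ≠ .x → s'.int v = s₁.int v) ∧
        (∀ v, v ≠ .rhs → v ≠ .base → s'.poly v = s₁.poly v) ∧
        π (s'.poly .rhs) = π (s₁.poly .f) ^ k ∧ (s'.poly .rhs).natDegree < n)
      (T₁ := 35 * (S : ℝ) ^ 2 * D) ?_
      fun s₂ hs₂ => RunsWithin.block_nil (Q := fun s' =>
        (∀ v, v ≠ .x → s'.int v = s.int v) ∧ s'.poly .f = s.poly .f ∧ s'.poly .m = m ∧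
        (s'.poly .lhs).natDegree < n ∧ (s'.poly .rhs).natDegree < n ∧
        (s'.poly .lhs = s'.poly .rhs ↔ π (s.poly .f) ^ (k + L) = π (s.poly .f) ^ k)) ?_)
        (by linarith) fun _ h => h
  · simp [ZExpr.val, hk, hL]
  · simp only [ZExpr.time, ZExpr.val, hk, hL]; omega
  · obtain ⟨a1, a2, a3, a4⟩ := hs₁
    refine powMod_runsWithin B hm hmn hmod hS (by decide) (by decide) ?_ ?_ ?_ ?_ ?_
    · rw [a2 _ (by decide) (by decide), hsm]
    · rwa [a2 _ (by decide) (by decide)]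
    · simp only [ZExpr.val]; rw [a1 _ (by decide), hk]
    · omega
    · simp only [ZExpr.time]; rw [a1 _ (by decide), hk]; omega
  · obtain ⟨a1, a2, a3, a4⟩ := hs₁
    obtain ⟨b1, b2, b3, b4⟩ := hs₂
    have hl : s₂.poly .lhs = s₁.poly .lhs := b2 _ (by decide) (by decide)
    have hf₁ : s₁.poly .f = s.poly .f := a2 _ (by decide) (by decide)
    refine ⟨fun v hv => by rw [b1 v hv, a1 v hv], by rw [b2 _ (by decide) (by decide), hf₁],
      by rw [b2 _ (by decide) (by decide), a2 _ (by decide) (by decide), hsm], hl ▸ a4, b4, ?_⟩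
    rw [← a3, ← hf₁, ← b3, hl]
    exact ⟨fun H => by rw [H], hinj _ _ a4 b4⟩

/-- The loop of the binary search ends with `h = H` or `h = H - 1`. -/
theorem search_runsWithin (B : CostBound M c h p e n lam D) (hm : m.Monic)
    (hmn : m.natDegree = n) (hmod : ∀ a, π (a %ₘ m) = π a)
    (hinj : ∀ a b, a.natDegree < n → b.natDegree < n → π a = π b → a = b)
    (hS : n * (e * lam) ≤ S) {s : State h p e} (hsm : s.poly .m = m)
    (hf : (s.poly .f).natDegree < n) {L H τ : ℕ} (hL : s.int .ellMax = L)
    (hLS : n * e + L < 2 ^ S)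
    (hH : ∀ k, π (s.poly .f) ^ (k + L) = π (s.poly .f) ^ k ↔ H ≤ k)
    (hl : s.int .l = τ) (hr : s.int .r = e * τ) (hτn : τ ≤ n) (hτH : τ ≤ H) (hHτ : H ≤ e * τ) :
    RunsWithin M c (.while (.leZ (.var .l) (.var .r)) (.block [
      .instr (.setZ .h (.add (.var .l) (.half (.sub (.var .r) (.var .l))))),
      bothSides,
      .ite (.eqP .lhs .rhs)
        (.instr (.setZ .r (.sub (.var .h) (.const 1))))
        (.instr (.setZ .l (.add (.var .h) (.const 1))))])) s (112 * lam * (S : ℝ) ^ 2 * D)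
      fun s' => s'.poly .f = s.poly .f ∧ s'.poly .m = m ∧ s'.int .ellMax = L ∧
        ∃ k : ℕ, s'.int .h = k ∧ k ≤ n * e ∧ (k = H ∨ k + 1 = H) := by
  have hn := B.one_lt_n
  have hlam := B.one_le_lam
  have he : 1 ≤ e := NeZero.one_le
  have hD := B.nonneg
  have hSlam : lam ≤ S := by
    refine le_trans ?_ hS
    rw [← mul_assoc]
    exact Nat.le_mul_of_pos_left _ (Nat.mul_pos (by omega) he)
  have hlam' : (1 : ℝ) ≤ lam := by exact_mod_cast hlam
  have hSlam' : (lam : ℝ) ≤ S := by exact_mod_cast hSlam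
  have heτ : e * τ ≤ n * e := by rw [mul_comm n]; exact Nat.mul_le_mul_left _ hτn
  -- The value $-1$ occurs: for `τ = 0` the search starts with `l = r = 0`, the test succeeds, and
  -- `r` becomes $-1$.
  have hbits : ∀ {a : ℤ}, -1 ≤ a → a ≤ (n * e : ℕ) → bits a ≤ lam + 1 := fun h1 h2 =>
    B.bits_le_of_le (by
      have : 1 ≤ n * e := Nat.mul_pos (by omega) he
      omega)
  -- The invariant $l\le H\le r+1$ allows `H` to be the discarded midpoint `r + 1`. At exit
  -- $l=H=r+1$, and the last midpoint `h` is `r + 1` or `l - 1`. The alternative `l ≤ r` covers the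
  -- start, when `h` has no prescribed value.
  set I : State h p e → Prop := fun s' =>
    s'.poly .f = s.poly .f ∧ s'.poly .m = m ∧ s'.int .ellMax = L ∧
    0 ≤ s'.int .l ∧ s'.int .l ≤ H ∧ (H : ℤ) ≤ s'.int .r + 1 ∧ s'.int .r ≤ (n * e : ℕ) ∧
    (s'.int .l ≤ s'.int .r ∨ ∃ k : ℕ, s'.int .h = k ∧ k ≤ n * e ∧
      ((k : ℤ) = s'.int .r + 1 ∨ (k : ℤ) + 1 = s'.int .l)) with hI
  -- The variant is the bit size of the number of candidates `r - l + 1`, initially at most `lam`.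
  have hloop := RunsWithin.while (M := M) (c := c) (s := s) (b := .leZ (.var .l) (.var .r))
    (P := .block [
      .instr (.setZ .h (.add (.var .l) (.half (.sub (.var .r) (.var .l))))),
      bothSides,
      .ite (.eqP .lhs .rhs)
        (.instr (.setZ .r (.sub (.var .h) (.const 1))))
        (.instr (.setZ .l (.add (.var .h) (.const 1))))])
    (T₁ := 8 * lam * D) (T₂ := 16 * lam * D + (70 * (S : ℝ) ^ 2 * D +
      (2 * S * D + 8 * lam * D + 0))) (N := lam) I
    (fun s' => Nat.size (s'.int .r - s'.int .l + 1).toNat) ?_ ?_ (by positivity) ?_ ?_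
  · refine hloop.mono ?_ ?_
    · have e1 : (lam : ℝ) * D ≤ lam * S ^ 2 * D := by
        gcongr
        exact le_mul_of_one_le_right (by positivity) (one_le_pow₀ (hlam'.trans hSlam'))
      have e2 : (lam : ℝ) * (lam * D) ≤ lam * S ^ 2 * D := by
        rw [mul_assoc (lam : ℝ)]
        gcongr
        nlinarith
      have e3 : (lam : ℝ) * (S * D) ≤ lam * S ^ 2 * D := by
        rw [mul_assoc (lam : ℝ)]
        gcongr
        nlinarith
      nlinarith
    · rintro s' ⟨⟨a1, a2, a3, a4, a5, a6, a7, a8⟩, hb⟩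
      simp only [Test.holds, ZExpr.val, not_le] at hb
      rcases a8 with a8 | ⟨k, a8, a9, a10⟩
      · omega
      · exact ⟨a1, a2, a3, k, a8, a9, by omega⟩
  · rintro s₁ ⟨a1, a2, a3, a4, a5, a6, a7, -⟩
    have h1 : bits (s₁.int .l) ≤ lam + 1 := hbits (by omega) (by omega)
    have h2 : bits (s₁.int .r) ≤ lam + 1 := hbits (by omega) (by omega)
    have := B.mul_le (x := bits (s₁.int .l) + bits (s₁.int .r) +
      (bits (s₁.int .l) + bits (s₁.int .r))) (y := 8 * lam) (by omega)
    simp only [Test.time, ZExpr.time, ZExpr.val]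
    push_cast at this
    exact this
  · rintro s₁ ⟨a1, a2, a3, a4, a5, a6, a7, -⟩ hb
    simp only [Test.holds, ZExpr.val] at hb
    obtain ⟨k, hk⟩ : ∃ k : ℕ, s₁.int .l + (s₁.int .r - s₁.int .l) / 2 = k :=
      ⟨_, (Int.toNat_of_nonneg (by omega)).symm⟩
    have hkn : k ≤ n * e := by omega
    refine RunsWithin.block_instr ?_ (RunsWithin.block_cons
      (bothSides_runsWithin B hm hmn hmod hinj hS (k := k) (L := L) ?_ ?_ ?_ ?_
        (by omega)) ?_)
    · have h1 : bits (s₁.int .l) ≤ lam + 1 := hbits (by omega) (by omega)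
      have h2 : bits (s₁.int .r) ≤ lam + 1 := hbits (by omega) (by omega)
      have h3 : bits (s₁.int .r - s₁.int .l) ≤ lam + 1 := hbits (by omega) (by omega)
      have h4 : bits ((s₁.int .r - s₁.int .l) / 2) ≤ lam + 1 := hbits (by omega) (by omega)
      simp only [Instr.time, ZExpr.time, ZExpr.val]
      refine (B.mul_le (y := 16 * lam) ?_).trans_eq (by push_cast; ring)
      omega
    · simpa [Instr.exec] using a2
    · simpa [Instr.exec, a1] using hf
    · simp [Instr.exec, ZExpr.val, hk]
    · simpa [Instr.exec] using a3
    · intro s₂ hs₂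
      simp only [Instr.exec, ZExpr.val, hk, a1] at hs₂
      obtain ⟨b1, b2, b3, b4, b5, b6⟩ := hs₂
      have bh : s₂.int .h = k := by rw [b1 _ (by decide)]; simp
      have bl : s₂.int .l = s₁.int .l := by rw [b1 _ (by decide)]; simp
      have br : s₂.int .r = s₁.int .r := by rw [b1 _ (by decide)]; simp
      have bL : s₂.int .ellMax = L := by rw [b1 _ (by decide)]; simp [a3]
      rw [hH] at b6
      have hbk : bits (k : ℤ) ≤ lam + 1 := hbits (by omega) (by omega)
      refine RunsWithin.block_cons (RunsWithin.ite (eqP_time_le B hS b4 b5) ?_ ?_)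
        fun s' hs' => RunsWithin.block_nil hs'
      · intro heq
        have hHk := b6.1 heq
        refine RunsWithin.instr ?_ ⟨?_, ?_⟩
        · simp only [Instr.time, ZExpr.time, ZExpr.val, bh, bits_one]
          refine (B.mul_le (y := 8 * lam) ?_).trans_eq (by push_cast; ring)
          omega
        · simp only [hI, Instr.exec, ZExpr.val, ne_eq, reduceCtorEq, not_false_eq_true,
            Function.update_of_ne, Function.update_self, bh, bl, bL]
          exact ⟨b2, b3, trivial, a4, a5, by omega, by omega, .inr ⟨k, rfl, hkn, .inl (by omega)⟩⟩
        · simp only [Instr.exec, ZExpr.val, ne_eq, reduceCtorEq, not_false_eq_true,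
            Function.update_of_ne, Function.update_self, bh, bl]
          exact size_le_of_two_mul_le (by omega) (by omega)
      · intro heq
        have hHk : ¬ H ≤ k := fun hle => heq (b6.2 hle)
        refine RunsWithin.instr ?_ ⟨?_, ?_⟩
        · simp only [Instr.time, ZExpr.time, ZExpr.val, bh, bits_one]
          refine (B.mul_le (y := 8 * lam) ?_).trans_eq (by push_cast; ring)
          omega
        · simp only [hI, Instr.exec, ZExpr.val, ne_eq, reduceCtorEq, not_false_eq_true,
            Function.update_of_ne, Function.update_self, bh, br, bL]
          exact ⟨b2, b3, trivial, by omega, by omega, a6, a7, .inr ⟨k, rfl, hkn, .inr rfl⟩⟩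
        · simp only [Instr.exec, ZExpr.val, ne_eq, reduceCtorEq, not_false_eq_true,
            Function.update_of_ne, Function.update_self, bh, br]
          exact size_le_of_two_mul_le (by omega) (by omega)
  · have hle : τ ≤ e * τ := Nat.le_mul_of_pos_left _ he
    refine ⟨rfl, hsm, hL, ?_, ?_, ?_, ?_, .inl ?_⟩ <;> simp only [hl, hr] <;> norm_cast <;> omega
  · rw [hl, hr]
    refine Nat.size_le.2 (lt_of_le_of_lt ?_ B.lt_two_pow)
    have h1 : (e * τ : ℤ) = (e * τ : ℕ) := by push_cast; rfl
    have h2 : 1 ≤ n * e := Nat.mul_pos (by omega) he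
    rw [h1]
    -- For `τ ≥ 1` there are $e\tau-\tau+1\le e\tau\le ne$ candidates; for `τ = 0` there is one.
    rcases Nat.eq_zero_or_pos τ with h0 | h0
    · subst h0; simp; omega
    · omega

end Search

/-! ### The height algorithm -/

section FactorList

variable {K : Type*} [CommRing K]

theorem factorList_bounds (hK : IsField K) {F : K[X]} (hF : F ≠ 0) {x : K[X] × ℕ}
    (hx : x ∈ factorList F) :
    x.1.Monic ∧ 1 ≤ x.1.natDegree ∧ x.1.natDegree ≤ F.natDegree ∧ 0 < x.2 ∧
      x.2 ≤ F.natDegree := by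
  let := hK.toField
  obtain ⟨⟨h1, h2, h3⟩, h4⟩ := (mem_factorList_iff hK hF x).1 hx
  have hpos : 1 ≤ x.1.natDegree := h2.natDegree_pos
  have hfin := FiniteMultiplicity.of_prime_left h2.prime hF
  refine ⟨h1, hpos, natDegree_le_of_dvd h3 hF, ?_, ?_⟩
  · rw [h4]
    exact hfin.le_multiplicity_of_pow_dvd (by simpa using h3)
  · have := natDegree_le_of_dvd (pow_multiplicity_dvd x.1 F) hF
    rw [natDegree_pow, ← h4] at this
    exact (Nat.le_mul_of_pos_right _ hpos).trans this

theorem multiplicity_of_not_dvd_left (hK : IsField K) {G a b : K[X]} (hG : Irreducible G)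
    (hab : a * b ≠ 0) (ha : ¬ G ∣ a) : multiplicity G (a * b) = multiplicity G b := by
  let := hK.toField
  rw [multiplicity_mul hG.prime (FiniteMultiplicity.of_prime_left hG.prime hab),
    multiplicity_eq_zero.2 ha, zero_add]

/-- The factors of `F` have the same multiplicities in `M1 * M2` and in `M2`, if none of them divides
`M1`. -/
theorem forall_mem_factorList_iff (hK : IsField K) {F M1 M2 m : K[X]} (hF : F ≠ 0) (hm : m ≠ 0)
    (hprod : M1 * M2 = m) (hM1 : ∀ x ∈ factorList F, ¬ x.1 ∣ M1) (k : ℕ) :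
    (∀ x ∈ factorList F, multiplicity x.1 M2 ≤ k * x.2) ↔
      ∀ G : K[X], G.Monic → Irreducible G → G ∣ F → multiplicity G m ≤ k * multiplicity G F := by
  subst hprod
  constructor
  · intro H G g1 g2 g3
    have hmem := (mem_factorList_iff hK hF (G, multiplicity G F)).2 ⟨⟨g1, g2, g3⟩, rfl⟩
    rw [multiplicity_of_not_dvd_left hK g2 hm (hM1 (G, multiplicity G F) hmem)]
    exact H (G, multiplicity G F) hmem
  · intro H x hx
    obtain ⟨⟨g1, g2, g3⟩, g4⟩ := (mem_factorList_iff hK hF x).1 hx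
    have := H x.1 g1 g2 g3
    rw [multiplicity_of_not_dvd_left hK g2 hm (hM1 _ hx)] at this
    rwa [g4]

end FactorList

section Algorithm

variable {h : ℤ[X]} {p e : ℕ} [NeZero e] {M : ℕ → ℕ → ℝ} {c n lam : ℕ} {D : ℝ}

/-- The dominant term is the search, $112\,$`lam`$\,S^2D$ with $S=2ne\cdot$`lam`; this is the source
of $n^2e^2\,$`lam`$^3D$. The constant 1000 exceeds the sum of all coefficients. -/
theorem heightAlgorithm_runsWithin (B : CostBound M c h p e n lam D) (hp : p.Prime)
    (hh : h.Monic) (hirr : Irreducible (h.map (Int.castRingHom (ZMod p))))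
    {f m : (AdjoinRoot h)[X]} (hf : f.Monic) (hm : m.Monic) (hmn : m.natDegree = n)
    (hfn : f.natDegree < n) {L H : ℕ} (hL0 : 0 < L)
    (hlog : Real.log (n * (p : ℝ) ^ h.natDegree) ≤ lam)
    (hLS : n * e + L < 2 ^ (2 * (n * (e * lam))))
    (hH : ∀ k, (Ideal.Quotient.mk (Ideal.span {proj h p e m}) (proj h p e f)) ^ (k + L) =
      (Ideal.Quotient.mk (Ideal.span {proj h p e m}) (proj h p e f)) ^ k ↔ H ≤ k)
    (hH' : ∀ k ℓ, 0 < ℓ → (Ideal.Quotient.mk (Ideal.span {proj h p e m}) (proj h p e f)) ^ (k + ℓ) =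
      (Ideal.Quotient.mk (Ideal.span {proj h p e m}) (proj h p e f)) ^ k → H ≤ k)
    {s : State h p e} (hsf : s.poly .f = proj h p e f) (hsm : s.poly .m = proj h p e m)
    (hse : s.int .e = e) (hsL : s.int .ellMax = L) :
    RunsWithin M c heightAlgorithm s (1000 * ((n : ℝ) ^ 2 * e ^ 2 * lam ^ 3 * D))
      fun s' => s'.int .out = H := by
  have hK := isField_GR_one hp hirr
  have hnt1 := nontrivial_GR_one hirr
  have hnt := nontrivial_GR (e := e) hirr
  have hn := B.one_lt_n
  have hlam := B.one_le_lam
  have he : 1 ≤ e := NeZero.one_le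
  have hD := B.nonneg
  have hn' : (1 : ℝ) ≤ n := by exact_mod_cast hn.le
  have hlam' : (1 : ℝ) ≤ lam := by exact_mod_cast hlam
  have he' : (1 : ℝ) ≤ e := by exact_mod_cast he
  have hpm : (proj h p e m).Monic := hm.map _
  have hpmn : (proj h p e m).natDegree = n := (hm.natDegree_map _).trans hmn
  have hpfn : (proj h p e f).natDegree < n := (hf.natDegree_map _).trans_lt hfn
  have hF0 : proj h p 1 f ≠ 0 := (hf.map _).ne_zero
  have hFn : (proj h p 1 f).natDegree < n := (hf.natDegree_map _).trans_lt hfn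
  have hm1 : proj h p 1 m ≠ 0 := (hm.map _).ne_zero
  have hbits : ∀ {k : ℕ}, k ≤ n * e → bits (k : ℤ) ≤ lam + 1 := fun hk =>
    B.bits_le_of_le (by simpa using hk)
  set S := 2 * (n * (e * lam)) with hSdef
  have hS : n * (e * lam) ≤ S := by omega
  set π := Ideal.Quotient.mk (Ideal.span {proj h p e m}) with hπ
  have hmod : ∀ a, π (a %ₘ proj h p e m) = π a := fun a => mk_modByMonic a _
  have hinj : ∀ a b : (GR h p e)[X], a.natDegree < n → b.natDegree < n → π a = π b → a = b :=
    fun a b ha hb hab => eq_of_mk_eq_of_natDegree_lt hpm (hpmn ▸ ha) (hpmn ▸ hb) hab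
  set FL := factorList (proj h p 1 f) with hFL
  have hbounds : FactorBounds n FL := fun x hx => by
    obtain ⟨h1, h2, h3, h4, h5⟩ := factorList_bounds hK hF0 hx
    exact ⟨h1, h2, by omega, h4, by omega⟩
  have hlen : FL.length ≤ n := (length_factorList_le hK hF0).trans hFn.le
  refine RunsWithin.mono (RunsWithin.block_instr (T₁ := n * (e * lam) ^ 2 * D) ?_
    (RunsWithin.block_instr (T₁ := n * lam * D) ?_ (RunsWithin.block_cons
      (decompose_runsWithin B ?_ ?_ ?_ ?_) fun s₁ hs₁ => RunsWithin.block_cons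
      (Q' := fun s₂ => s₂.int .e = e ∧ s₂.int .ellMax = L ∧ s₂.poly .f = proj h p e f ∧
        s₂.poly .m = proj h p e m ∧ ∃ τ : ℕ, s₂.int .tau = τ ∧ τ ≤ n ∧ τ ≤ H ∧ H ≤ e * τ)
      (T₁ := 45 * (n : ℝ) ^ 2 * e ^ 2 * lam ^ 2 * D) ?_ fun s₂ hs₂ =>
      RunsWithin.block_instr (T₁ := 8 * lam ^ 2 * D) ?_
      (RunsWithin.block_instr (T₁ := 2 * lam * D) ?_ (RunsWithin.block_cons
        (Q' := fun s₃ => s₃.poly .f = proj h p e f ∧ s₃.poly .m = proj h p e m ∧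
          s₃.int .ellMax = L ∧ ∃ k : ℕ, s₃.int .h = k ∧ k ≤ n * e ∧ (k = H ∨ k + 1 = H))
        (T₁ := 112 * lam * (S : ℝ) ^ 2 * D) ?_ fun s₃ hs₃ => ?_)))))
    (Q := fun s' => s'.int .out = H) (T := n * (e * lam) ^ 2 * D + (n * lam * D +
      (16 * (n : ℝ) ^ 2 * e ^ 2 * lam ^ 2 * D + (45 * (n : ℝ) ^ 2 * e ^ 2 * lam ^ 2 * D +
      (8 * lam ^ 2 * D + (2 * lam * D + (112 * lam * (S : ℝ) ^ 2 * D +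
      (70 * (S : ℝ) ^ 2 * D + (2 * S * D + 8 * lam * D + 0)))))))))
    ?_ fun _ h => h
  · have := B.mul_le (x := ((proj h p e f).natDegree + 1) * elemBits h p e ^ 2)
      (y := n * (e * lam) ^ 2) (Nat.mul_le_mul hpfn (Nat.pow_le_pow_left B.elemE 2))
    simp only [Instr.time, hsf]
    push_cast at this ⊢
    exact this
  -- The logarithm in the factoring time is at most `lam`, and `c * M 1 d` is at most `D`, so
  -- factoring takes at most $n\cdot$`lam`$\cdot D$.
  · simp only [Instr.time, Instr.exec, Function.update_self, hsf, map_residue_proj, factorTime]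
    set d := (proj h p 1 f).natDegree + 1 with hd
    have hdn : d ≤ n := hFn
    have hd1 : (1 : ℝ) ≤ d := by exact_mod_cast (show 1 ≤ d by omega)
    have hq : (1 : ℝ) ≤ (p : ℝ) ^ h.natDegree := one_le_pow₀ (by exact_mod_cast hp.one_le)
    have hlog' : Real.log (d * (p : ℝ) ^ h.natDegree) ≤ lam := by
      refine le_trans (Real.log_le_log (by positivity) ?_) hlog
      gcongr
    have hlog0 : 0 ≤ Real.log (d * (p : ℝ) ^ h.natDegree) :=
      Real.log_nonneg (one_le_mul_of_one_le_of_one_le hd1 hq)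
    have hdiv := B.divF d (by omega) hdn
    calc (c : ℝ) * (d * M 1 d * Real.log (d * (p : ℝ) ^ h.natDegree))
        = d * (Real.log (d * (p : ℝ) ^ h.natDegree) * (c * M 1 d)) := by ring
      _ ≤ d * (Real.log (d * (p : ℝ) ^ h.natDegree) * D) := by gcongr
      _ ≤ n * (lam * D) := by gcongr
      _ = n * lam * D := by ring
  · simpa [Instr.exec, hsm] using hpm
  · simpa [Instr.exec, hsm] using hpmn
  · simpa [Instr.exec, hsf, map_residue_proj] using hbounds
  · simpa [Instr.exec, hsf, map_residue_proj] using hlen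
  · simp only [Instr.exec, Function.update_self, hsf, hsm, map_residue_proj] at hs₁
    obtain ⟨a1, a2, a3, a4, a5, a6, a7⟩ := hs₁
    refine (fieldHeight_runsWithin B rfl a5 ?_ (a3 ▸ hbounds) (a3 ▸ hlen)).mono le_rfl ?_
    · have := a4.natDegree_mul a5
      rw [a6] at this
      have h2 : (proj h p 1 m).natDegree = n := (hm.natDegree_map _).trans hmn
      omega
    · rintro s₂ ⟨b1, b2, b3, τ, b4, b5, b6⟩
      refine ⟨by rw [b1, a1 _ (by decide), hse], by rw [b2, a1 _ (by decide), hsL],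
        by rw [b3, a2, hsf], by rw [b3, a2, hsm], τ, b4, b5, ?_⟩
      refine height_mem_Icc hp hh hirr hf hm hL0 hH hH' fun k => ?_
      rw [b6, a3]
      exact forall_mem_factorList_iff hK hF0 hm1 a6 a7 k
  · obtain ⟨b1, -, -, -, τ, b4, b5, -⟩ := hs₂
    have h1 : bits (e : ℤ) ≤ lam + 1 := hbits (Nat.le_mul_of_pos_left _ (by omega))
    have h2 : bits (τ : ℤ) ≤ lam + 1 := hbits (b5.trans CostBound.le_mul_e)
    have h3 := Nat.mul_le_mul h1 h2
    simp only [Instr.time, ZExpr.time, ZExpr.val, b1, b4]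
    refine (B.mul_le (y := 8 * lam ^ 2) ?_).trans_eq (by push_cast; ring)
    nlinarith
  · obtain ⟨b1, -, -, -, τ, b4, b5, -⟩ := hs₂
    have h2 : bits (τ : ℤ) ≤ lam + 1 := hbits (b5.trans CostBound.le_mul_e)
    simp only [Instr.time, Instr.exec, ZExpr.time, ZExpr.val, ne_eq, reduceCtorEq,
      not_false_eq_true, Function.update_of_ne, b4]
    refine (B.mul_le (y := 2 * lam) ?_).trans_eq (by push_cast; ring)
    omega
  · obtain ⟨b1, b2, b3, b4, τ, b5, b6, b7, b8⟩ := hs₂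
    refine (search_runsWithin (A := (GR h p e)[X] ⧸ Ideal.span {proj h p e m})
      (π := π) B hpm hpmn hmod hinj hS (L := L) (H := H) (τ := τ)
      ?_ ?_ ?_ hLS ?_ ?_ ?_ b6 b7 b8).mono le_rfl ?_
    · simpa [Instr.exec] using b4
    · simpa [Instr.exec, b3] using hpfn
    · simpa [Instr.exec] using b2
    · simpa only [Instr.exec, b3] using hH
    · simp [Instr.exec, ZExpr.val, b5]
    · simp [Instr.exec, ZExpr.val, b1, b5]
    · intro s₃ hs₃
      simpa only [Instr.exec, b3] using hs₃
  · obtain ⟨a1, a2, a3, k, a4, a5, a6⟩ := hs₃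
    refine RunsWithin.block_cons (bothSides_runsWithin
      (A := (GR h p e)[X] ⧸ Ideal.span {proj h p e m}) (π := π) B hpm hpmn hmod hinj hS a2 (a1 ▸ hpfn) a4 a3
      (by omega)) fun s₄ hs₄ => ?_
    rw [a1, hH] at hs₄
    obtain ⟨b1, -, -, b4, b5, b6⟩ := hs₄
    have bh : s₄.int .h = k := by rw [b1 _ (by decide), a4]
    have hbk := hbits a5
    -- Since `h` is `H` or `H - 1`, the last test succeeds exactly when it is `H`.
    refine RunsWithin.block_cons (RunsWithin.ite (eqP_time_le B hS b4 b5) ?_ ?_)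
      fun s' hs' => RunsWithin.block_nil hs'
    · intro heq
      have hHk := b6.1 heq
      refine RunsWithin.instr ?_ ?_
      · simp only [Instr.time, ZExpr.time, bh]
        refine (B.mul_le (y := 8 * lam) ?_).trans_eq (by push_cast; ring)
        omega
      · simp only [Instr.exec, ZExpr.val, Function.update_self, bh]
        omega
    · intro heq
      have hHk : ¬ H ≤ k := fun hle => heq (b6.2 hle)
      refine RunsWithin.instr ?_ ?_
      · simp only [Instr.time, ZExpr.time, ZExpr.val, bh, bits_one]
        refine (B.mul_le (y := 8 * lam) ?_).trans_eq (by push_cast; ring)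
        omega
      · simp only [Instr.exec, ZExpr.val, Function.update_self, bh]
        omega
  · have key := fun {a b c : ℕ} => pow_mul_pow_mul_pow_le (a := a) (b := b) (c := c) (a' := 2)
      (b' := 2) (c' := 3) hn' he' hlam' hD
    have e1 := key (show 1 ≤ 2 by simp) (show 2 ≤ 2 by simp) (show 2 ≤ 3 by simp)
    have e2 := key (show 1 ≤ 2 by simp) (show 0 ≤ 2 by simp) (show 1 ≤ 3 by simp)
    have e3 := key (show 2 ≤ 2 by simp) (show 2 ≤ 2 by simp) (show 2 ≤ 3 by simp)
    have e4 := key (show 0 ≤ 2 by simp) (show 0 ≤ 2 by simp) (show 2 ≤ 3 by simp)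
    have e5 := key (show 0 ≤ 2 by simp) (show 0 ≤ 2 by simp) (show 1 ≤ 3 by simp)
    have e6 := key (show 1 ≤ 2 by simp) (show 1 ≤ 2 by simp) (show 1 ≤ 3 by simp)
    have hSr : (S : ℝ) = 2 * (n * (e * lam)) := by rw [hSdef]; push_cast; ring
    rw [hSr]
    simp only [pow_zero, pow_one, one_mul, mul_one] at e1 e2 e3 e4 e5 e6
    nlinarith

end Algorithm

/-! ### Bit sizes, logarithms and the choice of the cost parameters -/

section Logarithms

/-- The size is at most $\log N/\log 2+1$, and $N\ge4$ exceeds Euler's number, so $\log N\ge1$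
absorbs the summand 1. -/
theorem size_le_three_mul_log {N : ℕ} (hN : 4 ≤ N) : (Nat.size N : ℝ) ≤ 3 * Real.log N := by
  have hN' : (4 : ℝ) ≤ N := by exact_mod_cast hN
  have h0 : 1 ≤ Nat.size N := Nat.size_pos.2 (by omega)
  have hlog1 : 1 ≤ Real.log N := by
    rw [Real.le_log_iff_exp_le (by linarith)]
    have := Real.exp_one_lt_d9
    linarith
  have h1 : 2 ^ (Nat.size N - 1) ≤ N := Nat.lt_size.1 (by omega)
  have h2 : ((2 : ℝ) ^ (Nat.size N - 1)) ≤ N := by exact_mod_cast h1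
  have h3 := Real.log_le_log (by positivity) h2
  rw [Real.log_pow, Nat.cast_sub h0, Nat.cast_one] at h3
  have h4 := Real.log_two_gt_d9
  have h5 : (1 : ℝ) ≤ Nat.size N := by exact_mod_cast h0
  nlinarith

theorem log_le_size {N : ℕ} (hN : 0 < N) : Real.log N ≤ Nat.size N := by
  have hN' : (0 : ℝ) < N := by exact_mod_cast hN
  have h2 : (N : ℝ) ≤ 2 ^ Nat.size N := by exact_mod_cast (Nat.lt_size_self N).le
  have h3 := Real.log_le_log hN' h2
  rw [Real.log_pow] at h3
  have h4 := Real.log_two_lt_d9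
  have h5 : (0 : ℝ) ≤ Nat.size N := Nat.cast_nonneg _
  nlinarith

/-- As $\mathcal M_e(n)\ge1$ and $\mathcal M$ is monotone, $(c+1)\mathcal M_e(n)$ dominates `c`, all
multiplication times that occur, and `c` times these. -/
theorem costBound_of_isMulTime {M : ℕ → ℕ → ℝ} (hM : IsMulTime M) (c : ℕ) (h : ℤ[X])
    {p e n lam : ℕ} (hn : 1 < n) (he : 1 ≤ e) (hlam : 1 ≤ lam) (hne : n * e < 2 ^ lam)
    (hq : p ^ h.natDegree < 2 ^ lam) : CostBound M c h p e n lam (((c : ℝ) + 1) * M e n) := by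
  have hMn : 1 ≤ M e n := hM.one_le e n he (by omega)
  have hc0 : (0 : ℝ) ≤ c := Nat.cast_nonneg c
  have hclog : Nat.clog 2 (p ^ h.natDegree) ≤ lam := Nat.clog_le_of_le_pow hq.le
  have hME : ∀ k, 1 ≤ k → k ≤ n → M e k ≤ M e n := fun k h1 h2 => hM.mono _ _ _ _ he le_rfl h1 h2
  have hMF : ∀ k, 1 ≤ k → k ≤ n → M 1 k ≤ M e n := fun k h1 h2 => hM.mono _ _ _ _ le_rfl he h1 h2
  have hmulD : ∀ {x : ℝ}, x ≤ M e n → x ≤ ((c : ℝ) + 1) * M e n := fun hx => by nlinarith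
  have hdivD : ∀ {x : ℝ}, x ≤ M e n → c * x ≤ ((c : ℝ) + 1) * M e n := fun hx => by nlinarith
  exact
    { one_lt_n := hn
      one_le_lam := hlam
      c_le := by nlinarith
      mulE := fun k h1 h2 => hmulD (hME k h1 h2)
      divE := fun k h1 h2 => hdivD (hME k h1 h2)
      mulF := fun k h1 h2 => hmulD (hMF k h1 h2)
      divF := fun k h1 h2 => hdivD (hMF k h1 h2)
      elemF := by rw [elemBits, one_mul]; exact hclog
      elemE := Nat.mul_le_mul_left _ hclog
      lt_two_pow := hne }

/-- Both $ne$ and $L\le q^{en}$ are at most $2^{ne\cdot\mathrm{lam}}$; doubling the exponent makes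
room for their sum, which bounds the exponents `h + ellMax`. -/
theorem add_lt_two_pow_of_le_pow {n e lam q L : ℕ} (hne1 : 1 ≤ n * e) (hlam : 1 ≤ lam)
    (hne : n * e < 2 ^ lam) (hq : q < 2 ^ lam) (hL : L ≤ q ^ (e * n)) :
    n * e + L < 2 ^ (2 * (n * (e * lam))) := by
  have h1 : L ≤ 2 ^ (n * (e * lam)) := by
    refine hL.trans ?_
    rw [show n * (e * lam) = lam * (e * n) by ring, pow_mul 2]
    exact Nat.pow_le_pow_left hq.le _
  have h0 : lam ≤ n * (e * lam) := by
    rw [← mul_assoc]; exact Nat.le_mul_of_pos_left _ hne1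
  have h2 : n * e < 2 ^ (n * (e * lam)) :=
    hne.trans_le (Nat.pow_le_pow_right (by norm_num) h0)
  calc n * e + L < 2 ^ (n * (e * lam)) + 2 ^ (n * (e * lam)) := by omega
    _ = 2 ^ (n * (e * lam) + 1) := by ring
    _ ≤ 2 ^ (2 * (n * (e * lam))) := Nat.pow_le_pow_right (by norm_num) (by omega)

end Logarithms

end GaloisHeight

theorem mainTheorem5 (c : ℕ) :
    ∃ (C : ℝ) (K : ℕ), ∀ (M : ℕ → ℕ → ℝ), IsMulTime M →
      ∀ (p : ℕ) (h : ℤ[X]), p.Prime → h.Monic →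
        Irreducible (h.map (Int.castRingHom (ZMod p))) →
      ∀ (e : ℕ) [NeZero e] (f m : (AdjoinRoot h)[X]), f.Monic → m.Monic →
        1 ≤ f.natDegree → f.natDegree < m.natDegree →
      ∀ ellMax : ℕ, IsGreatest (cycleLengths (mulSystem h p e f m)) ellMax →
      ∀ s : State h p e,
        s.poly .f = proj h p e f → s.poly .m = proj h p e m →
        s.int .e = e → s.int .ellMax = ellMax →
      ∃ (s' : State h p e) (t : ℝ) (H : ℕ),
        Runs M c heightAlgorithm s s' t ∧
        IsSystemHeight (mulSystem h p e f m) H ∧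
        s'.int .out = H ∧
        t ≤ C * ((m.natDegree : ℝ) ^ 2 * (e : ℝ) ^ 2 * M e m.natDegree) *
          Real.log (m.natDegree * e * (p : ℝ) ^ h.natDegree) ^ K := by
  -- The bound $1000\,n^2e^2\,$`lam`$^3D$ with `lam` at most $3\log(neq)$ gives $1000\cdot3^3=27000$
  -- and the third power of the logarithm; $c+1$ comes from `D`.
  refine ⟨27000 * ((c : ℝ) + 1), 3, ?_⟩
  intro M hM p h hp hh hirr e _ f m hf hm hf1 hfm L hL s hsf hsm hse hsL
  have he : 1 ≤ e := NeZero.one_le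
  have hnt := nontrivial_GR (e := e) hirr
  have hpm : (proj h p e m).Monic := hm.map _
  have hpmn : (proj h p e m).natDegree = m.natDegree := hm.natDegree_map _
  obtain ⟨hfin, hcard⟩ := card_quotient_le (e := e) hp hh hpm
  obtain ⟨H, hsys, hL0, hLcard, hH, hH'⟩ := exists_isSystemHeight_mul
    (Γ := mulSystem h p e f m)
    (a := Ideal.Quotient.mk (Ideal.span {proj h p e m}) (proj h p e f)) (fun _ => rfl) hL
  have hLq := hLcard.trans hcard
  rw [hpmn] at hLq
  generalize hn : m.natDegree = n at hfm hLq ⊢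
  have hq2 : 2 ≤ p ^ h.natDegree := by
    have : Fact p.Prime := ⟨hp⟩
    have hd := hirr.natDegree_pos
    rw [hh.natDegree_map] at hd
    exact hp.two_le.trans (Nat.le_self_pow hd.ne' p)
  -- Here $n\ge2$ because $1\le\deg f<n$, and $q\ge2$ because an irreducible polynomial over
  -- $\mathbb F_p$ has positive degree; so $neq\ge4$.
  have hne2 : 2 ≤ n * e := le_trans (by omega) (Nat.le_mul_of_pos_right n he)
  have hN4 : 4 ≤ n * e * p ^ h.natDegree := Nat.mul_le_mul hne2 hq2
  have hcast : (n : ℝ) * e * (p : ℝ) ^ h.natDegree = ((n * e * p ^ h.natDegree : ℕ) : ℝ) := by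
    push_cast; rfl
  have hlt := Nat.lt_size_self (n * e * p ^ h.natDegree)
  have hlam1 : 1 ≤ Nat.size (n * e * p ^ h.natDegree) := Nat.size_pos.2 (by omega)
  have hlam3 := size_le_three_mul_log hN4
  have hloglam : Real.log (n * (p : ℝ) ^ h.natDegree) ≤ Nat.size (n * e * p ^ h.natDegree) := by
    have h1 : n * p ^ h.natDegree ≤ n * e * p ^ h.natDegree :=
      Nat.mul_le_mul_right _ (Nat.le_mul_of_pos_right n he)
    have h2 : 0 < n * p ^ h.natDegree := Nat.mul_pos (by omega) (by omega)
    have h3 : ((n * p ^ h.natDegree).size : ℝ) ≤ (n * e * p ^ h.natDegree).size := by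
      exact_mod_cast Nat.size_le_size h1
    have h4 := (log_le_size h2).trans h3
    push_cast at h4
    exact h4
  rw [hcast]
  generalize Nat.size (n * e * p ^ h.natDegree) = lam at hlt hlam1 hlam3 hloglam
  have hne_lt : n * e < 2 ^ lam := lt_of_le_of_lt (Nat.le_mul_of_pos_right _ (by omega)) hlt
  have hq_lt : p ^ h.natDegree < 2 ^ lam :=
    lt_of_le_of_lt (Nat.le_mul_of_pos_left _ (by omega)) hlt
  have B := costBound_of_isMulTime hM c h (p := p) (by omega) he hlam1 hne_lt hq_lt
  obtain ⟨s', t, hrun, ht, hout⟩ := heightAlgorithm_runsWithin B hp hh hirr hf hm hn hfm hL0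
    hloglam (add_lt_two_pow_of_le_pow (by omega) hlam1 hne_lt hq_lt hLq) hH hH' hsf hsm hse hsL
  refine ⟨s', t, H, hrun, hsys, hout, ht.trans ?_⟩
  have hM0 : 0 ≤ M e n := zero_le_one.trans (hM.one_le e n he (by omega))
  generalize Real.log ((n * e * p ^ h.natDegree : ℕ) : ℝ) = Λ at hlam3
  calc 1000 * ((n : ℝ) ^ 2 * e ^ 2 * lam ^ 3 * (((c : ℝ) + 1) * M e n))
      ≤ 1000 * ((n : ℝ) ^ 2 * e ^ 2 * (3 * Λ) ^ 3 * (((c : ℝ) + 1) * M e n)) := by gcongr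
    _ = 27000 * ((c : ℝ) + 1) * ((n : ℝ) ^ 2 * e ^ 2 * M e n) * Λ ^ 3 := by ring
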